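/- Let $G$ be a conflict graph on $N$ nodes with $M$ channels, $K=NM$. Its extended conflict graph $H$ has the $K$ vertices $(i,j)$ ($1\le i\le N$, $1\le j\le M$); distinct vertices $(i,j),(i,j')$ of one node are adjacent, and $(i,j),(p,j)$ are adjacent when $i,p$ are adjacent in $G$. The feasible strategies are the independent sets of $H$. In round $t=1,2,\dots$ vertex $v$ has data rate $\xi_v(t)\in[0,1]$; the vectors $(\xi_v(t))_v$ are i.i.d. over $t$, with unknown means $\mu_v$. For a feasible strategy $x$ put $\lambda_x=\sum_{v\in x}\mu_v$, and $R_1=\max_x\lambda_x$. Learning policy: after $t$ rounds let $m_v$ be the number of rounds in which $v$ was selected and $\tilde\mu_v$ the mean of the rates of $v$ observed in these rounds; the estimated weight of $v$ is $$w_v(t+1)=\tilde\mu_v+\sqrt{\max\bigl(\ln\tfrac{t^{2/3}}{K m_v},\,0\bigr)/m_v},\qquad w_v(t+1)=+\infty \text{ if } m_v=0 .$$ For $\beta>0$, the $\beta$-approximation learning policy selects in each round, from the information available before that round (past rates and, possibly, random bits), a feasible strategy whose total estimated weight is at least $1/\beta$ times the maximum total estimated weight of a feasible strategy. With $T_x(n)$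 the number of times strategy $x$ is played in the first $n$ rounds, its $\beta$-regret is $$\mathfrak R_\beta(n)=\sum_x\Bigl(\frac{R_1}{\beta}-\lambda_x\Bigr)\mathbb E[T_x(n)].$$ Each round of length $t_a=t_s+t_d$ consists of strategy decision (time $t_s\ge 0$) and data transmission (time $t_d>0$), so that with $\theta=t_d/t_a$ the throughput gained in round $t$ by the selected strategy $x(t)$ is $\theta\sum_{v\in x(t)}\xi_v(t)$. **Theorem.** Let $\alpha>0$, and let the channel access scheme be run with strategy decisions of approximation ratio $\beta=\theta\alpha$, i.e. as a $\theta\alpha$-approximation learning policy. Then for every $n\ge 0$ its practical regret satisfies $$ n\frac{R_1}{\alpha}-\mathbb E\Bigl[\sum_{t=1}^n\theta\sum_{v\in x(t)}\xi_v(t)\Bigr]=\theta\,\mathfrak R_{\theta\alpha}(n),$$ and, for all distributions of the rates on $[0,1]$, $$\theta\,\mathfrak R_{\theta\alpha}(n)\le\frac1\alpha NK+\Bigl(\theta\sqrt{eK}+\frac{16}{e\alpha}(1+N)N^3\Bigr)n^{2/3}+\frac1\alpha\Bigl(1+\frac{4\sqrt K\,N^2}{e(\theta\alpha)^2}\Bigr)N^2K\,n^{5/6}.$$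 -/

import Mathlib

open MeasureTheory ProbabilityTheory
open scoped ENNReal

noncomputable section

namespace ChannelAccess

/-- The extended conflict graph `H` of a conflict graph `G` on `N` nodes with `M` channels.
The vertex `(i, j)` stands for "node `i` uses channel `j`".  The `M` vertices of one node form
a clique, and `(i, j)`, `(p, j)` are joined when `i` and `p` conflict in `G`. -/
def extendedConflictGraph {N : ℕ} (M : ℕ) (G : SimpleGraph (Fin N)) :
    SimpleGraph (Fin N × Fin M) where
  Adj u v := (u.1 = v.1 ∧ u.2 ≠ v.2) ∨ (u.2 = v.2 ∧ G.Adj u.1 v.1)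
  symm := ⟨by
    rintro u v (⟨h, h'⟩ | ⟨h, h'⟩)
    · exact Or.inl ⟨h.symm, h'.symm⟩
    · exact Or.inr ⟨h.symm, h'.symm⟩⟩
  loopless := ⟨by
    rintro u (⟨_, h⟩ | ⟨_, h⟩)
    · exact h rfl
    · exact h.ne rfl⟩

open scoped Classical in
/-- The feasible strategy set: all independent sets of the extended conflict graph. -/
def feasibleStrategies {N : ℕ} (M : ℕ) (G : SimpleGraph (Fin N)) :
    Finset (Finset (Fin N × Fin M)) :=
  Finset.univ.filter fun F => (extendedConflictGraph M G).IsIndepSet (F : Set (Fin N × Fin M))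

theorem feasibleStrategies_nonempty {N : ℕ} (M : ℕ) (G : SimpleGraph (Fin N)) :
    (feasibleStrategies M G).Nonempty :=
  ⟨∅, by simp [feasibleStrategies, SimpleGraph.IsIndepSet]⟩

/-- Mean throughput `λ_F` of a strategy `F` when the vertices have mean rates `μ`. -/
def meanThroughput {N M : ℕ} (μ : Fin N × Fin M → ℝ) (F : Finset (Fin N × Fin M)) : ℝ :=
  ∑ v ∈ F, μ v

/-- `R₁`, the largest mean throughput of a feasible strategy. -/
def optThroughput {N M : ℕ} (G : SimpleGraph (Fin N)) (μ : Fin N × Fin M → ℝ) : ℝ :=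
  (feasibleStrategies M G).sup' (feasibleStrategies_nonempty M G) (meanThroughput μ)

section RateModel

variable {N M : ℕ} {Ω : Type*} [mΩ : MeasurableSpace Ω]

/-- `ξ t ω v` is the data rate of vertex `v` in round `t` (rounds are numbered `0, 1, 2, …`), and
`ℱ t` is the information available before round `t`: at least all rates of earlier rounds, and
possibly random bits of the users.  The rate vectors of the rounds are independent and
identically distributed (the next vector is independent of everything in `ℱ t`), and the rates
lie in `[0, 1]`.  The rates of distinct vertices in one round may have any joint law. -/
structure IsRateProcess (P : Measure Ω) (ℱ : Filtration ℕ mΩ)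
    (ξ : ℕ → Ω → Fin N × Fin M → ℝ) : Prop where
  measurable : ∀ t, Measurable[ℱ (t + 1)] (ξ t)
  indep : ∀ t, Indep (MeasurableSpace.comap (ξ t) inferInstance) (ℱ t) P
  identDistrib : ∀ t, IdentDistrib (ξ t) (ξ 0) P P
  mem_Icc : ∀ t v, ∀ᵐ ω ∂P, ξ t ω v ∈ Set.Icc (0 : ℝ) 1

/-- The mean rate `μ_v` of vertex `v`. -/
def meanRate (P : Measure Ω) (ξ : ℕ → Ω → Fin N × Fin M → ℝ) (v : Fin N × Fin M) : ℝ :=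
  ∫ ω, ξ 0 ω v ∂P

/-- `m_v`: how often vertex `v` was selected in the first `t` rounds. -/
def numPlays (s : ℕ → Ω → Finset (Fin N × Fin M)) (t : ℕ) (ω : Ω) (v : Fin N × Fin M) : ℕ :=
  ((Finset.range t).filter fun τ => v ∈ s τ ω).card

/-- The observed mean rate of vertex `v` over those of the first `t` rounds in which `v` was
selected. -/
def observedMean (ξ : ℕ → Ω → Fin N × Fin M → ℝ) (s : ℕ → Ω → Finset (Fin N × Fin M))
    (t : ℕ) (ω : Ω) (v : Fin N × Fin M) : ℝ :=
  (∑ τ ∈ (Finset.range t).filter (fun τ => v ∈ s τ ω), ξ τ ω v) / (numPlays s t ω v : ℝ)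

/-- The estimated weight of vertex `v` after `t` rounds, used in the next decision: observed mean
plus `√(max (ln (t^(2/3) / (K m))) 0 / m)` with `K = N M`.  A vertex without any observation
(`m = 0`) has weight `∞`. -/
def estimatedWeight (ξ : ℕ → Ω → Fin N × Fin M → ℝ) (s : ℕ → Ω → Finset (Fin N × Fin M))
    (t : ℕ) (ω : Ω) (v : Fin N × Fin M) : ℝ≥0∞ :=
  if numPlays s t ω v = 0 then ∞
  else ENNReal.ofReal (observedMean ξ s t ω v +
    √(max (Real.log ((t : ℝ) ^ (2 / 3 : ℝ) /
      (((N : ℝ) * (M : ℝ)) * (numPlays s t ω v : ℝ)))) 0 / (numPlays s t ω v : ℝ)))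

/-- The `β`-approximation learning policy: in each round the selected strategy `s t` depends only
on information available before the round, is feasible, and has estimated weight at least `1/β`
of the largest estimated weight of a feasible strategy. -/
structure IsApproxLearningPolicy (G : SimpleGraph (Fin N)) (P : Measure Ω) (ℱ : Filtration ℕ mΩ)
    (ξ : ℕ → Ω → Fin N × Fin M → ℝ) (β : ℝ) (s : ℕ → Ω → Finset (Fin N × Fin M)) : Prop where
  nonanticipating : ∀ t F, MeasurableSet[ℱ t] {ω | s t ω = F}
  feasible : ∀ t ω, s t ω ∈ feasibleStrategies M G
  approx : ∀ t, ∀ᵐ ω ∂P, ∀ F ∈ feasibleStrategies M G,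
    ∑ v ∈ F, estimatedWeight ξ s t ω v ≤
      ENNReal.ofReal β * ∑ v ∈ s t ω, estimatedWeight ξ s t ω v

/-- `T_F(n)`: how often the strategy `F` is played in the first `n` rounds. -/
def timesPlayed (s : ℕ → Ω → Finset (Fin N × Fin M)) (n : ℕ) (F : Finset (Fin N × Fin M))
    (ω : Ω) : ℕ :=
  ((Finset.range n).filter fun t => s t ω = F).card

/-- The `β`-regret `∑_F (R₁ / β - λ_F) E[T_F(n)]`, summed over the feasible strategies `F`. -/
def betaRegret (G : SimpleGraph (Fin N)) (P : Measure Ω) (ξ : ℕ → Ω → Fin N × Fin M → ℝ)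
    (s : ℕ → Ω → Finset (Fin N × Fin M)) (β : ℝ) (n : ℕ) : ℝ :=
  ∑ F ∈ feasibleStrategies M G,
    (optThroughput G (meanRate P ξ) / β - meanThroughput (meanRate P ξ) F) *
      ∫ ω, (timesPlayed s n F ω : ℝ) ∂P

/-- The practical regret: `n R₁ / α` minus the expected effective throughput of the first `n`
rounds, where only a fraction `θ` of each round is used for data transmission. -/
def practicalRegret (G : SimpleGraph (Fin N)) (P : Measure Ω) (ξ : ℕ → Ω → Fin N × Fin M → ℝ)
    (s : ℕ → Ω → Finset (Fin N × Fin M)) (θ α : ℝ) (n : ℕ) : ℝ :=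
  (n : ℝ) * (optThroughput G (meanRate P ξ) / α) -
    ∫ ω, ∑ t ∈ Finset.range n, θ * ∑ v ∈ s t ω, ξ t ω v ∂P

end RateModel

end ChannelAccess

end

/-!
The practical regret equals `θ` times the `θα`-regret because the rates of a round are independent
of the strategy chosen for it (`practicalRegret_eq`), so everything rests on a bound for the
`β`-regret (`betaRegret_le_explicit`).

Write `Z` for the accumulated noise of a vertex (the sum of its observed centred rates) and `m` for
its number of observations, so that the observed mean is `μ_v + Z / m`.  A round either plays a
vertex for the first time, which happens at most `K` times, or has only finite estimated weights.
In the latter case the approximation property bounds the regret of the round by `1 / β` times the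
underestimation `(-Z / m - bonus)⁺`, summed over a fixed optimal strategy, plus the overestimation
`|Z| / m + bonus`, summed over the strategy played (`round_regret_le`).

* Observation errors.  For a decreasing weight `h` the process `Z² h(m)` gains at most
  `h(m + 1) / 4` in conditional expectation at a play and loses `Z² (h(m) - h(m + 1))`
  (`integral_sq_noise_add_drop_le`).  With `h(m) = m ^ (-1/2)` the losses control
  `∑ |Z| / m` over all plays by `2 √n` (`integral_sum_playedError_le`).
* Underestimation in round `t`.  If `m` exceeds about `t ^ (1/3)`, the same estimate with a weight
  `1 / max(m, m₀)²` bounds `E |Z| / m` by a multiple of `t ^ (-1/6)`.  For smaller `m` the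
  supermartingale `exp (l Z - l² m / 8)` (`integral_exp_noise_le_one`) and a union bound over the
  values of `m` give a multiple of `K² t ^ (-1/3)`.  Summed over the rounds this yields the powers
  `n ^ (5/6)` and `n ^ (2/3)` (`sum_integral_shortfall_le`).
* Bonuses.  By `ln x ≤ x / e` the bonus at a play is at most `√(n ^ (2/3) / (e K)) / m`, and the
  plays of a vertex give a harmonic sum (`sum_explorationBonus_le`).

The constants fit because the trivial bound `n N / β` already suffices unless `n ^ (1/3)` exceeds
`(16 / e) (1 + N) N² + N K n ^ (1/6)`; beyond this threshold all lower-order terms are absorbed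
(`regret_constants_le`).
-/

namespace ChannelAccess

/-! ### Sums of powers -/

/-- Bernoulli's inequality `(1 - 1 / (k + 1)) ^ p ≤ 1 - p / (k + 1)`. -/
theorem rpow_add_mul_rpow_le_succ {p : ℝ} (hp0 : 0 ≤ p) (hp1 : p ≤ 1) (k : ℕ) :
    (k : ℝ) ^ p + p * ((k : ℝ) + 1) ^ (p - 1) ≤ ((k : ℝ) + 1) ^ p := by
  have hk : (0 : ℝ) < (k : ℝ) + 1 := by positivity
  have hinv : 1 / ((k : ℝ) + 1) ≤ 1 := by
    rw [div_le_one hk]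
    linarith [(Nat.cast_nonneg k : (0 : ℝ) ≤ k)]
  have hB := rpow_one_add_le_one_add_mul_self (s := -(1 / ((k : ℝ) + 1))) (by linarith) hp0 hp1
  have h1 : (k : ℝ) = ((k : ℝ) + 1) * (1 + -(1 / ((k : ℝ) + 1))) := by
    field_simp
    ring
  have h2 : (k : ℝ) ^ p = ((k : ℝ) + 1) ^ p * (1 + -(1 / ((k : ℝ) + 1))) ^ p := by
    conv_lhs => rw [h1]
    exact Real.mul_rpow hk.le (by linarith)
  have h3 : ((k : ℝ) + 1) ^ (p - 1) = ((k : ℝ) + 1) ^ p * (1 / ((k : ℝ) + 1)) := by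
    rw [Real.rpow_sub_one hk.ne']
    ring
  have h4 := mul_le_mul_of_nonneg_left hB (Real.rpow_nonneg hk.le p)
  rw [h2, h3]
  linarith

theorem sum_succ_rpow_le {p : ℝ} (hp0 : 0 < p) (hp1 : p ≤ 1) (n : ℕ) :
    ∑ j ∈ Finset.range n, ((j : ℝ) + 1) ^ (p - 1) ≤ (n : ℝ) ^ p / p := by
  induction n with
  | zero => simp [Real.zero_rpow hp0.ne']
  | succ k ih =>
    rw [Finset.sum_range_succ, le_div_iff₀ hp0]
    rw [le_div_iff₀ hp0] at ih
    have := rpow_add_mul_rpow_le_succ hp0.le hp1 k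
    push_cast
    linarith

theorem sum_rpow_le {p : ℝ} (hp0 : 0 < p) (hp1 : p < 1) (n : ℕ) :
    ∑ j ∈ Finset.range n, (j : ℝ) ^ (p - 1) ≤ (n : ℝ) ^ p / p := by
  cases n with
  | zero => simp [Real.zero_rpow hp0.ne']
  | succ k =>
    rw [Finset.sum_range_succ']
    have h0 : (((0 : ℕ) : ℝ)) ^ (p - 1) = 0 := by
      rw [Nat.cast_zero, Real.zero_rpow (by linarith)]
    rw [h0, add_zero]
    push_cast
    refine (sum_succ_rpow_le hp0 hp1.le k).trans ?_
    gcongr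
    linarith

/-- The second-moment weights `1 / max (j + 1) m ^ 2` are constant up to `m` and telescope
after `m`; each half contributes at most `1 / m`. -/
theorem sum_inv_max_sq_le {m : ℕ} (hm : 1 ≤ m) (t : ℕ) :
    ∑ j ∈ Finset.range t, 1 / ((max (j + 1) m : ℕ) : ℝ) ^ 2 ≤ 2 / (m : ℝ) := by
  have hm0 : (0 : ℝ) < m := by exact_mod_cast hm
  have key : ∀ t : ℕ, ∑ j ∈ Finset.range t, 1 / ((max (j + 1) m : ℕ) : ℝ) ^ 2 ≤
      ((min t m : ℕ) : ℝ) / (m : ℝ) ^ 2 + 1 / (m : ℝ) - 1 / ((max t m : ℕ) : ℝ) := by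
    intro t
    induction t with
    | zero => simp
    | succ k ih =>
      rw [Finset.sum_range_succ]
      rcases lt_or_ge k m with h | h
      · rw [min_eq_left h.le, max_eq_right h.le] at ih
        rw [min_eq_left (Nat.succ_le_of_lt h), max_eq_right (Nat.succ_le_of_lt h),
          Nat.cast_succ, add_div]
        linarith
      · rw [min_eq_right h, max_eq_left h] at ih
        rw [min_eq_right (h.trans k.le_succ), max_eq_left (h.trans k.le_succ)]
        have hk : (0 : ℝ) < k := lt_of_lt_of_le hm0 (by exact_mod_cast h)
        have : 1 / (((k + 1 : ℕ) : ℝ)) ^ 2 ≤ 1 / (k : ℝ) - 1 / (((k + 1 : ℕ) : ℝ)) := by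
          push_cast
          rw [div_sub_div _ _ hk.ne' (by positivity),
            div_le_div_iff₀ (by positivity) (by positivity)]
          nlinarith
        linarith
  refine (key t).trans ?_
  have h1 : ((min t m : ℕ) : ℝ) / (m : ℝ) ^ 2 ≤ 1 / (m : ℝ) := by
    rw [div_le_div_iff₀ (by positivity) hm0]
    have : ((min t m : ℕ) : ℝ) ≤ m := by exact_mod_cast min_le_right t m
    nlinarith
  have h2 : 0 ≤ 1 / ((max t m : ℕ) : ℝ) := by positivity
  have h3 : 2 / (m : ℝ) = 1 / m + 1 / m := by ring
  linarith

theorem one_div_sqrt_sub_ge {m : ℝ} (hm : 1 ≤ m) :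
    1 / (4 * (m * √m)) ≤ 1 / √m - 1 / √(m + 1) := by
  have hm0 : 0 < m := by linarith
  have hs : 0 < √m := Real.sqrt_pos.2 hm0
  have hs1 : 0 < √(m + 1) := Real.sqrt_pos.2 (by linarith)
  -- With `x = 1 / m` this is `1 / √(1 + x) ≤ 1 - x / 4` on `[0, 1]`.
  have h : 4 * (m * √m) ≤ (4 * m - 1) * √(m + 1) := by
    have h' : 4 * (m * √m) = √(16 * m ^ 3) := by
      rw [show 16 * m ^ 3 = (4 * m) ^ 2 * m by ring, Real.sqrt_mul (by positivity),
        Real.sqrt_sq (by positivity)]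
      ring
    have h'' : (4 * m - 1) * √(m + 1) = √((4 * m - 1) ^ 2 * (m + 1)) := by
      rw [Real.sqrt_mul (by positivity), Real.sqrt_sq (by linarith)]
    rw [h', h'']
    apply Real.sqrt_le_sqrt
    nlinarith
  have e : 1 / √m - 1 / √(m + 1) - 1 / (4 * (m * √m)) =
      ((4 * m - 1) * √(m + 1) - 4 * (m * √m)) / (4 * (m * √m) * √(m + 1)) := by
    field_simp
    ring
  have : 0 ≤ 1 / √m - 1 / √(m + 1) - 1 / (4 * (m * √m)) := by
    rw [e]
    apply div_nonneg <;> [linarith; positivity]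
  linarith

/-! ### Numbers of plays and accumulated noise -/

section Sampling

variable {N M : ℕ} {Ω : Type*}

theorem numPlays_zero (s : ℕ → Ω → Finset (Fin N × Fin M)) (ω : Ω) (v : Fin N × Fin M) :
    numPlays s 0 ω v = 0 := by
  simp [numPlays]

theorem numPlays_succ (s : ℕ → Ω → Finset (Fin N × Fin M)) (t : ℕ) (ω : Ω) (v : Fin N × Fin M) :
    numPlays s (t + 1) ω v = numPlays s t ω v + if v ∈ s t ω then 1 else 0 := by
  unfold numPlays
  rw [Finset.range_add_one, Finset.filter_insert]
  split_ifs
  · rw [Finset.card_insert_of_notMem (by simp)]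
  · rfl

theorem numPlays_le (s : ℕ → Ω → Finset (Fin N × Fin M)) (t : ℕ) (ω : Ω) (v : Fin N × Fin M) :
    numPlays s t ω v ≤ t := by
  simpa [numPlays] using Finset.card_filter_le (Finset.range t) (fun τ => v ∈ s τ ω)

/-- Along the rounds in which `v` is played, the number of earlier plays of `v` runs through
`0, 1, 2, …`. -/
theorem sum_plays_eq (s : ℕ → Ω → Finset (Fin N × Fin M)) (ω : Ω) (v : Fin N × Fin M)
    (f : ℕ → ℝ) (n : ℕ) :
    ∑ t ∈ Finset.range n, (if v ∈ s t ω then f (numPlays s t ω v) else 0) =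
      ∑ j ∈ Finset.range (numPlays s n ω v), f j := by
  induction n with
  | zero => simp [numPlays_zero]
  | succ n ih =>
    rw [Finset.sum_range_succ, ih, numPlays_succ]
    split_ifs
    · rw [Finset.sum_range_succ]
    · simp

theorem sum_plays_le (s : ℕ → Ω → Finset (Fin N × Fin M)) (ω : Ω) (v : Fin N × Fin M)
    {f : ℕ → ℝ} (hf : ∀ j, 0 ≤ f j) (n : ℕ) :
    ∑ t ∈ Finset.range n, (if v ∈ s t ω then f (numPlays s t ω v) else 0) ≤
      ∑ j ∈ Finset.range n, f j := by
  rw [sum_plays_eq]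
  exact Finset.sum_le_sum_of_subset_of_nonneg
    (Finset.range_mono (numPlays_le s n ω v)) fun j _ _ => hf j

variable [mΩ : MeasurableSpace Ω]

/-- The accumulated noise of vertex `v` before round `t`: the sum of the centred rates
`ξ_v - μ_v` over the rounds in which `v` was played. -/
noncomputable def noise (P : Measure Ω) (ξ : ℕ → Ω → Fin N × Fin M → ℝ)
    (s : ℕ → Ω → Finset (Fin N × Fin M)) (v : Fin N × Fin M) (t : ℕ) (ω : Ω) : ℝ :=
  ∑ τ ∈ (Finset.range t).filter (fun τ => v ∈ s τ ω), (ξ τ ω v - meanRate P ξ v)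

theorem noise_zero (P : Measure Ω) (ξ : ℕ → Ω → Fin N × Fin M → ℝ)
    (s : ℕ → Ω → Finset (Fin N × Fin M)) (v : Fin N × Fin M) (ω : Ω) :
    noise P ξ s v 0 ω = 0 := by
  simp [noise]

theorem noise_succ (P : Measure Ω) (ξ : ℕ → Ω → Fin N × Fin M → ℝ)
    (s : ℕ → Ω → Finset (Fin N × Fin M)) (v : Fin N × Fin M) (t : ℕ) (ω : Ω) :
    noise P ξ s v (t + 1) ω =
      noise P ξ s v t ω + if v ∈ s t ω then ξ t ω v - meanRate P ξ v else 0 := by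
  unfold noise
  rw [Finset.range_add_one, Finset.filter_insert]
  split_ifs
  · rw [Finset.sum_insert (by simp), add_comm]
  · simp

theorem observedMean_eq (P : Measure Ω) (ξ : ℕ → Ω → Fin N × Fin M → ℝ)
    (s : ℕ → Ω → Finset (Fin N × Fin M)) (v : Fin N × Fin M) (t : ℕ) (ω : Ω)
    (h : numPlays s t ω v ≠ 0) :
    observedMean ξ s t ω v =
      meanRate P ξ v + noise P ξ s v t ω / (numPlays s t ω v : ℝ) := by
  have h' : (numPlays s t ω v : ℝ) ≠ 0 := by exact_mod_cast h
  have : noise P ξ s v t ω = (∑ τ ∈ (Finset.range t).filter (fun τ => v ∈ s τ ω), ξ τ ω v) -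
      (numPlays s t ω v : ℝ) * meanRate P ξ v := by
    simp [noise, Finset.sum_sub_distrib, numPlays]
  rw [observedMean, this]
  field_simp
  ring

theorem abs_noise_le {P : Measure Ω} {ξ : ℕ → Ω → Fin N × Fin M → ℝ}
    (s : ℕ → Ω → Finset (Fin N × Fin M)) {v : Fin N × Fin M} {ω : Ω}
    (h : ∀ t, |ξ t ω v - meanRate P ξ v| ≤ 1) (t : ℕ) :
    |noise P ξ s v t ω| ≤ numPlays s t ω v := by
  unfold noise
  refine (Finset.abs_sum_le_sum_abs _ _).trans ?_
  refine (Finset.sum_le_sum fun τ _ => h τ).trans ?_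
  simp [numPlays]

/-! ### Measurability and one-round moments -/

variable {P : Measure Ω} {ℱ : Filtration ℕ mΩ} {ξ : ℕ → Ω → Fin N × Fin M → ℝ}
  {s : ℕ → Ω → Finset (Fin N × Fin M)}

theorem measurableSet_mem (hs : ∀ t F, MeasurableSet[ℱ t] {ω | s t ω = F}) (t : ℕ)
    (v : Fin N × Fin M) : MeasurableSet[ℱ t] {ω | v ∈ s t ω} := by
  have : {ω | v ∈ s t ω} = ⋃ F ∈ {F : Finset (Fin N × Fin M) | v ∈ F}, {ω | s t ω = F} := by
    ext ω
    simp
  rw [this]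
  exact MeasurableSet.biUnion (Set.to_countable _) fun F _ => hs t F

theorem measurable_numPlays (hs : ∀ t F, MeasurableSet[ℱ t] {ω | s t ω = F}) (t : ℕ)
    (v : Fin N × Fin M) : Measurable[ℱ t] fun ω => numPlays s t ω v := by
  induction t with
  | zero => simpa only [numPlays_zero] using measurable_const
  | succ t ih =>
    simp only [numPlays_succ]
    have hle : ℱ t ≤ ℱ (t + 1) := ℱ.mono t.le_succ
    exact (ih.mono hle le_rfl).add
      (Measurable.ite (hle _ (measurableSet_mem hs t v)) measurable_const measurable_const)

theorem IsRateProcess.measurable_apply (hξ : IsRateProcess P ℱ ξ) (t : ℕ) (v : Fin N × Fin M) :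
    Measurable fun ω => ξ t ω v :=
  (measurable_pi_apply v).comp ((hξ.measurable t).mono (ℱ.le _) le_rfl)

theorem measurable_noise (hξ : IsRateProcess P ℱ ξ)
    (hs : ∀ t F, MeasurableSet[ℱ t] {ω | s t ω = F}) (t : ℕ)
    (v : Fin N × Fin M) : Measurable[ℱ t] (noise P ξ s v t) := by
  induction t with
  | zero =>
    have : noise P ξ s v 0 = fun _ => 0 := funext (noise_zero P ξ s v)
    rw [this]
    exact measurable_const
  | succ t ih =>
    have : noise P ξ s v (t + 1) = fun ω => noise P ξ s v t ω +
        if v ∈ s t ω then ξ t ω v - meanRate P ξ v else 0 := funext (noise_succ P ξ s v t)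
    rw [this]
    have hle : ℱ t ≤ ℱ (t + 1) := ℱ.mono t.le_succ
    have hx : Measurable[ℱ (t + 1)] fun ω => ξ t ω v :=
      (measurable_pi_apply v).comp (hξ.measurable t)
    exact (ih.mono hle le_rfl).add
      (Measurable.ite (hle _ (measurableSet_mem hs t v)) (hx.sub_const _) measurable_const)

/-- The rate of round `t` is independent of the information available before the round. -/
theorem IsRateProcess.integral_mul_comp (hξ : IsRateProcess P ℱ ξ) {t : ℕ} (v : Fin N × Fin M)
    {g : Ω → ℝ} (hg : Measurable[ℱ t] g) {φ : ℝ → ℝ} (hφ : Measurable φ) :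
    ∫ ω, g ω * φ (ξ t ω v) ∂P = (∫ ω, g ω ∂P) * ∫ ω, φ (ξ t ω v) ∂P := by
  have hind : IndepFun (fun ω => φ (ξ t ω v)) g P := by
    rw [IndepFun_iff_Indep]
    refine indep_of_indep_of_le_left (indep_of_indep_of_le_right (hξ.indep t) hg.comap_le) ?_
    rintro _ ⟨B, hB, rfl⟩
    exact ⟨(fun x : Fin N × Fin M → ℝ => φ (x v)) ⁻¹' B,
      (hφ.comp (measurable_pi_apply v)) hB, rfl⟩
  exact hind.symm.integral_fun_mul_eq_mul_integral
    ((hg.mono (ℱ.le t) le_rfl).aestronglyMeasurable)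
    ((hφ.comp (hξ.measurable_apply t v)).aestronglyMeasurable)

theorem IsRateProcess.integral_comp_eq (hξ : IsRateProcess P ℱ ξ) (t : ℕ) (v : Fin N × Fin M)
    {φ : ℝ → ℝ} (hφ : Measurable φ) :
    ∫ ω, φ (ξ t ω v) ∂P = ∫ ω, φ (ξ 0 ω v) ∂P :=
  ((hξ.identDistrib t).comp (u := fun x : Fin N × Fin M → ℝ => φ (x v))
    (hφ.comp (measurable_pi_apply v))).integral_eq

theorem IsRateProcess.ae_mem_Icc (hξ : IsRateProcess P ℱ ξ) :
    ∀ᵐ ω ∂P, ∀ t v, ξ t ω v ∈ Set.Icc (0 : ℝ) 1 :=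
  ae_all_iff.2 fun t => ae_all_iff.2 fun v => hξ.mem_Icc t v

variable [IsProbabilityMeasure P]

theorem IsRateProcess.meanRate_mem_Icc (hξ : IsRateProcess P ℱ ξ) (v : Fin N × Fin M) :
    meanRate P ξ v ∈ Set.Icc (0 : ℝ) 1 := by
  have hint : Integrable (fun ω => ξ 0 ω v) P :=
    Integrable.of_mem_Icc 0 1 (hξ.measurable_apply 0 v).aemeasurable (hξ.mem_Icc 0 v)
  constructor
  · exact integral_nonneg_of_ae ((hξ.mem_Icc 0 v).mono fun ω h => h.1)
  · have := integral_mono_ae hint (integrable_const (1 : ℝ)) ((hξ.mem_Icc 0 v).mono fun ω h => h.2)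
    simpa [meanRate] using this

theorem IsRateProcess.ae_abs_sub_le (hξ : IsRateProcess P ℱ ξ) :
    ∀ᵐ ω ∂P, ∀ t v, |ξ t ω v - meanRate P ξ v| ≤ 1 := by
  filter_upwards [hξ.ae_mem_Icc] with ω h t v
  have h1 := h t v
  have h2 := hξ.meanRate_mem_Icc v
  exact abs_sub_le_iff.2 ⟨by linarith [h1.2, h2.1], by linarith [h1.1, h2.2]⟩

theorem IsRateProcess.integral_sub_meanRate (hξ : IsRateProcess P ℱ ξ) (t : ℕ)
    (v : Fin N × Fin M) : ∫ ω, (ξ t ω v - meanRate P ξ v) ∂P = 0 := by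
  rw [hξ.integral_comp_eq t v (φ := fun x => x - meanRate P ξ v) (by fun_prop)]
  have hint : Integrable (fun ω => ξ 0 ω v) P :=
    Integrable.of_mem_Icc 0 1 (hξ.measurable_apply 0 v).aemeasurable (hξ.mem_Icc 0 v)
  rw [integral_sub hint (integrable_const _)]
  simp [meanRate]

theorem IsRateProcess.integral_sub_meanRate_sq_le (hξ : IsRateProcess P ℱ ξ) (t : ℕ)
    (v : Fin N × Fin M) : ∫ ω, (ξ t ω v - meanRate P ξ v) ^ 2 ∂P ≤ 1 / 4 := by
  rw [hξ.integral_comp_eq t v (φ := fun x => (x - meanRate P ξ v) ^ 2) (by fun_prop)]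
  have h := variance_le_sq_of_bounded (hξ.mem_Icc 0 v) (hξ.measurable_apply 0 v).aemeasurable
  rw [variance_eq_integral (hξ.measurable_apply 0 v).aemeasurable] at h
  refine h.trans ?_
  norm_num

theorem IsRateProcess.integral_exp_le (hξ : IsRateProcess P ℱ ξ) (t : ℕ)
    (v : Fin N × Fin M) (l : ℝ) :
    ∫ ω, Real.exp (l * (ξ t ω v - meanRate P ξ v)) ∂P ≤ Real.exp (l ^ 2 / 8) := by
  rw [hξ.integral_comp_eq t v (φ := fun x => Real.exp (l * (x - meanRate P ξ v))) (by fun_prop)]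
  have h := (hasSubgaussianMGF_of_mem_Icc (hξ.measurable_apply 0 v).aemeasurable
    (hξ.mem_Icc 0 v)).mgf_le l
  refine h.trans (le_of_eq ?_)
  congr 1
  simp
  ring

end Sampling

section Moments

variable {N M : ℕ} {Ω : Type*} [mΩ : MeasurableSpace Ω] {P : Measure Ω}
  {ℱ : Filtration ℕ mΩ} {ξ : ℕ → Ω → Fin N × Fin M → ℝ} {s : ℕ → Ω → Finset (Fin N × Fin M)}

/-! ### Second moments and exponential moments of the accumulated noise -/

/-- The decrease of `Z² h(m)`, with `Z` the accumulated noise and `m` the number of plays of `v`,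
that a play of `v` in round `t` causes through the weight `h` alone; it is `0` if `v` is not
played. -/
noncomputable def potentialDrop (P : Measure Ω) (ξ : ℕ → Ω → Fin N × Fin M → ℝ)
    (s : ℕ → Ω → Finset (Fin N × Fin M)) (h : ℕ → ℝ) (v : Fin N × Fin M) (t : ℕ) (ω : Ω) : ℝ :=
  if v ∈ s t ω then
    noise P ξ s v t ω ^ 2 * (h (numPlays s t ω v) - h (numPlays s t ω v + 1))
  else 0

theorem measurable_potentialDrop (hξ : IsRateProcess P ℱ ξ)
    (hs : ∀ t F, MeasurableSet[ℱ t] {ω | s t ω = F}) (h : ℕ → ℝ) (v : Fin N × Fin M) (t : ℕ) :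
    Measurable[ℱ t] (potentialDrop P ξ s h v t) :=
  Measurable.ite (measurableSet_mem hs t v)
    (((measurable_noise hξ hs t v).pow_const 2).mul
      ((measurable_from_nat (f := fun j => h j - h (j + 1))).comp (measurable_numPlays hs t v)))
    measurable_const

variable [IsProbabilityMeasure P]

theorem ae_abs_noise_le (hξ : IsRateProcess P ℱ ξ) :
    ∀ᵐ ω ∂P, ∀ t v, |noise P ξ s v t ω| ≤ numPlays s t ω v := by
  filter_upwards [hξ.ae_abs_sub_le] with ω h t v
  exact abs_noise_le s (fun t => h t v) t

theorem ae_noise_sq_le (hξ : IsRateProcess P ℱ ξ) (t : ℕ) (v : Fin N × Fin M) :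
    ∀ᵐ ω ∂P, noise P ξ s v t ω ^ 2 ≤ (t : ℝ) ^ 2 := by
  filter_upwards [ae_abs_noise_le (s := s) hξ] with ω h
  have h1 : (numPlays s t ω v : ℝ) ≤ t := by exact_mod_cast numPlays_le s t ω v
  exact sq_le_sq.2 (((h t v).trans h1).trans (le_abs_self _))

theorem integrable_sq_noise_mul (hξ : IsRateProcess P ℱ ξ)
    (hs : ∀ t F, MeasurableSet[ℱ t] {ω | s t ω = F}) {h : ℕ → ℝ} (h0 : ∀ j, 0 ≤ h j)
    (hanti : Antitone h) (v : Fin N × Fin M) (t : ℕ) :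
    Integrable (fun ω => noise P ξ s v t ω ^ 2 * h (numPlays s t ω v)) P := by
  have hm := (measurable_numPlays hs t v).mono (ℱ.le t) le_rfl
  have hZ := (measurable_noise hξ hs t v).mono (ℱ.le t) le_rfl
  refine Integrable.of_bound ((hZ.pow_const 2).mul
    ((measurable_from_nat (f := h)).comp hm)).aestronglyMeasurable ((t : ℝ) ^ 2 * h 0) ?_
  filter_upwards [ae_noise_sq_le (s := s) hξ t v] with ω hω
  rw [Real.norm_of_nonneg (mul_nonneg (sq_nonneg _) (h0 _))]
  exact mul_le_mul hω (hanti (Nat.zero_le _)) (h0 _) (sq_nonneg _)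

theorem integrable_potentialDrop (hξ : IsRateProcess P ℱ ξ)
    (hs : ∀ t F, MeasurableSet[ℱ t] {ω | s t ω = F}) {h : ℕ → ℝ} (h0 : ∀ j, 0 ≤ h j)
    (hanti : Antitone h) (v : Fin N × Fin M) (t : ℕ) :
    Integrable (potentialDrop P ξ s h v t) P := by
  refine Integrable.of_bound ((measurable_potentialDrop hξ hs h v t).mono
    (ℱ.le t) le_rfl).aestronglyMeasurable ((t : ℝ) ^ 2 * h 0) ?_
  filter_upwards [ae_noise_sq_le (s := s) hξ t v] with ω hω
  unfold potentialDrop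
  split_ifs
  · have h1 := hanti (Nat.le_succ (numPlays s t ω v))
    have h2 := hanti (Nat.zero_le (numPlays s t ω v))
    have h3 := h0 (numPlays s t ω v + 1)
    rw [Real.norm_of_nonneg (mul_nonneg (sq_nonneg _) (sub_nonneg.2 h1))]
    exact mul_le_mul hω (by linarith) (sub_nonneg.2 h1) (sq_nonneg _)
  · simpa using mul_nonneg (sq_nonneg _) (h0 0)

/-- One round of the second-moment recursion: a play of `v` adds at most the variance `1/4` of a
rate to the conditional expectation of `Z²`, while the weight `h` moves on to its next value. -/
theorem integral_sq_noise_succ_le (hξ : IsRateProcess P ℱ ξ)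
    (hs : ∀ t F, MeasurableSet[ℱ t] {ω | s t ω = F}) {h : ℕ → ℝ} (h0 : ∀ j, 0 ≤ h j)
    (hanti : Antitone h) (v : Fin N × Fin M) (t : ℕ) :
    ∫ ω, noise P ξ s v (t + 1) ω ^ 2 * h (numPlays s (t + 1) ω v) ∂P +
        ∫ ω, potentialDrop P ξ s h v t ω ∂P ≤
      ∫ ω, noise P ξ s v t ω ^ 2 * h (numPlays s t ω v) ∂P +
        1 / 4 * ∫ ω, (if v ∈ s t ω then h (numPlays s t ω v + 1) else 0) ∂P := by
  have hm := measurable_numPlays hs t v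
  have hZ := measurable_noise hξ hs t v
  have hA := measurableSet_mem hs t v
  have hh1 : Measurable[ℱ t] fun ω => h (numPlays s t ω v + 1) :=
    (measurable_from_nat (f := fun j => h (j + 1))).comp hm
  set g₁ : Ω → ℝ := fun ω =>
    if v ∈ s t ω then 2 * noise P ξ s v t ω * h (numPlays s t ω v + 1) else 0 with hg₁
  set g₂ : Ω → ℝ := fun ω => if v ∈ s t ω then h (numPlays s t ω v + 1) else 0 with hg₂
  have mg₁ : Measurable[ℱ t] g₁ := Measurable.ite hA ((hZ.const_mul 2).mul hh1) measurable_const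
  have mg₂ : Measurable[ℱ t] g₂ := Measurable.ite hA hh1 measurable_const
  have mx : Measurable fun ω => ξ t ω v := hξ.measurable_apply t v
  have hh : ∀ j, h j ≤ h 0 := fun j => hanti (Nat.zero_le j)
  have i₁ : Integrable (fun ω => g₁ ω * (ξ t ω v - meanRate P ξ v)) P := by
    refine Integrable.of_bound ((mg₁.mono (ℱ.le t) le_rfl).mul
      (mx.sub_const _)).aestronglyMeasurable (2 * t * h 0) ?_
    filter_upwards [ae_abs_noise_le (s := s) hξ, hξ.ae_abs_sub_le] with ω hω hx
    rw [Real.norm_eq_abs, abs_mul]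
    have hb : |g₁ ω| ≤ 2 * t * h 0 := by
      simp only [hg₁]
      split_ifs
      · rw [abs_mul, abs_mul, abs_two, abs_of_nonneg (h0 _)]
        have h1 : (numPlays s t ω v : ℝ) ≤ t := by exact_mod_cast numPlays_le s t ω v
        exact mul_le_mul (mul_le_mul_of_nonneg_left ((hω t v).trans h1) zero_le_two)
          (hh _) (h0 _) (by positivity)
      · simpa using mul_nonneg (by positivity) (h0 0)
    calc |g₁ ω| * |ξ t ω v - meanRate P ξ v| ≤ 2 * t * h 0 * 1 :=
          mul_le_mul hb (hx t v) (abs_nonneg _) ((abs_nonneg _).trans hb)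
      _ = _ := mul_one _
  have i₂ : Integrable (fun ω => g₂ ω * (ξ t ω v - meanRate P ξ v) ^ 2) P := by
    refine Integrable.of_bound ((mg₂.mono (ℱ.le t) le_rfl).mul
      ((mx.sub_const _).pow_const 2)).aestronglyMeasurable (h 0) ?_
    filter_upwards [hξ.ae_abs_sub_le] with ω hx
    rw [Real.norm_eq_abs, abs_mul, abs_pow]
    have hb : |g₂ ω| ≤ h 0 := by
      simp only [hg₂]
      split_ifs
      · rw [abs_of_nonneg (h0 _)]
        exact hh _
      · simpa using h0 0
    calc |g₂ ω| * |ξ t ω v - meanRate P ξ v| ^ 2 ≤ h 0 * 1 :=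
          mul_le_mul hb (pow_le_one₀ (abs_nonneg _) (hx t v)) (by positivity) (h0 0)
      _ = _ := mul_one _
  have i₀ := integrable_sq_noise_mul hξ hs h0 hanti v t
  have i₃ := integrable_sq_noise_mul hξ hs h0 hanti v (t + 1)
  have i₄ := integrable_potentialDrop hξ hs h0 hanti v t
  have e₁ := hξ.integral_mul_comp v mg₁ (φ := fun x => x - meanRate P ξ v) (by fun_prop)
  have e₂ := hξ.integral_mul_comp v mg₂ (φ := fun x => (x - meanRate P ξ v) ^ 2) (by fun_prop)
  rw [hξ.integral_sub_meanRate, mul_zero] at e₁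
  rw [← integral_add i₃ i₄]
  have hpt : ∀ ω, noise P ξ s v (t + 1) ω ^ 2 * h (numPlays s (t + 1) ω v) +
      potentialDrop P ξ s h v t ω = noise P ξ s v t ω ^ 2 * h (numPlays s t ω v) +
        (g₁ ω * (ξ t ω v - meanRate P ξ v) + g₂ ω * (ξ t ω v - meanRate P ξ v) ^ 2) := by
    intro ω
    simp only [noise_succ, numPlays_succ, potentialDrop, hg₁, hg₂]
    split_ifs
    · ring
    · simp
  simp only [hpt]
  have i₅ : Integrable (fun ω => g₁ ω * (ξ t ω v - meanRate P ξ v) +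
      g₂ ω * (ξ t ω v - meanRate P ξ v) ^ 2) P := i₁.add i₂
  rw [integral_add i₀ i₅, integral_add i₁ i₂, e₁, e₂, zero_add, mul_comm (1 / 4 : ℝ)]
  have : 0 ≤ ∫ ω, g₂ ω ∂P := integral_nonneg fun ω => by
    simp only [hg₂]
    split_ifs
    · exact h0 _
    · exact le_rfl
  gcongr
  exact hξ.integral_sub_meanRate_sq_le t v

/-- The second-moment budget: for a decreasing weight `h`, the plays of `v` feed at most
`h 1 + … + h n` times the variance bound `1/4` into `Z² h(m)`, which pays both for its final value
and for all drops of the weight. -/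
theorem integral_sq_noise_add_drop_le (hξ : IsRateProcess P ℱ ξ)
    (hs : ∀ t F, MeasurableSet[ℱ t] {ω | s t ω = F}) {h : ℕ → ℝ} (h0 : ∀ j, 0 ≤ h j)
    (hanti : Antitone h) (v : Fin N × Fin M) (n : ℕ) :
    ∫ ω, noise P ξ s v n ω ^ 2 * h (numPlays s n ω v) ∂P +
        ∑ t ∈ Finset.range n, ∫ ω, potentialDrop P ξ s h v t ω ∂P ≤
      1 / 4 * ∑ j ∈ Finset.range n, h (j + 1) := by
  have key : ∫ ω, noise P ξ s v n ω ^ 2 * h (numPlays s n ω v) ∂P +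
        ∑ t ∈ Finset.range n, ∫ ω, potentialDrop P ξ s h v t ω ∂P ≤
      1 / 4 * ∑ t ∈ Finset.range n,
        ∫ ω, (if v ∈ s t ω then h (numPlays s t ω v + 1) else 0) ∂P := by
    induction n with
    | zero => simp [noise_zero]
    | succ n ih =>
      rw [Finset.sum_range_succ, Finset.sum_range_succ, mul_add]
      linarith [integral_sq_noise_succ_le hξ hs h0 hanti v n]
  refine key.trans (mul_le_mul_of_nonneg_left ?_ (by norm_num))
  have hint : ∀ t, Integrable
      (fun ω => if v ∈ s t ω then h (numPlays s t ω v + 1) else 0) P := by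
    intro t
    refine Integrable.of_bound ((Measurable.ite (measurableSet_mem hs t v)
      ((measurable_from_nat (f := fun j => h (j + 1))).comp (measurable_numPlays hs t v))
      measurable_const).mono (ℱ.le t) le_rfl).aestronglyMeasurable (h 0)
      (Filter.Eventually.of_forall fun ω => ?_)
    split_ifs
    · rw [Real.norm_of_nonneg (h0 _)]
      exact hanti (Nat.zero_le _)
    · simpa using h0 0
  rw [← integral_finsetSum _ fun t _ => hint t]
  refine (integral_mono (integrable_finsetSum _ fun t _ => hint t) (integrable_const
    (∑ j ∈ Finset.range n, h (j + 1))) fun ω =>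
      sum_plays_le s ω v (f := fun j => h (j + 1)) (fun j => h0 _) n).trans ?_
  simp

theorem integrable_exp_noise (hξ : IsRateProcess P ℱ ξ)
    (hs : ∀ t F, MeasurableSet[ℱ t] {ω | s t ω = F}) (l : ℝ) (v : Fin N × Fin M) (t : ℕ) :
    Integrable (fun ω => Real.exp (l * noise P ξ s v t ω - l ^ 2 / 8 * numPlays s t ω v)) P := by
  have hm : Measurable fun ω => (numPlays s t ω v : ℝ) :=
    (measurable_from_nat (f := fun j : ℕ => (j : ℝ))).comp
      ((measurable_numPlays hs t v).mono (ℱ.le t) le_rfl)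
  have hZ := (measurable_noise hξ hs t v).mono (ℱ.le t) le_rfl
  refine Integrable.of_bound (((hZ.const_mul l).sub (hm.const_mul _)).exp).aestronglyMeasurable
    (Real.exp (|l| * t)) ?_
  filter_upwards [ae_abs_noise_le (s := s) hξ] with ω hω
  rw [Real.norm_of_nonneg (Real.exp_nonneg _), Real.exp_le_exp]
  have h1 : (numPlays s t ω v : ℝ) ≤ t := by exact_mod_cast numPlays_le s t ω v
  have h2 : l * noise P ξ s v t ω ≤ |l| * t :=
    (le_abs_self _).trans ((abs_mul _ _).le.trans
      (mul_le_mul_of_nonneg_left ((hω t v).trans h1) (abs_nonneg l)))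
  have h3 : 0 ≤ l ^ 2 / 8 * (numPlays s t ω v : ℝ) := by positivity
  linarith

/-- By Hoeffding's lemma, `exp (l Z_t - l² m_t / 8)` is a supermartingale. -/
theorem integral_exp_noise_le_one (hξ : IsRateProcess P ℱ ξ)
    (hs : ∀ t F, MeasurableSet[ℱ t] {ω | s t ω = F}) (l : ℝ) (v : Fin N × Fin M) (t : ℕ) :
    ∫ ω, Real.exp (l * noise P ξ s v t ω - l ^ 2 / 8 * numPlays s t ω v) ∂P ≤ 1 := by
  induction t with
  | zero => simp [noise_zero, numPlays_zero]
  | succ t ih =>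
    refine le_trans ?_ ih
    have hm : Measurable[ℱ t] fun ω => (numPlays s t ω v : ℝ) :=
      (measurable_from_nat (f := fun j : ℕ => (j : ℝ))).comp (measurable_numPlays hs t v)
    have hZ := measurable_noise hξ hs t v
    have hA := measurableSet_mem hs t v
    set E : Ω → ℝ := fun ω =>
      Real.exp (l * noise P ξ s v t ω - l ^ 2 / 8 * numPlays s t ω v) with hE
    have mE : Measurable[ℱ t] E := ((hZ.const_mul l).sub (hm.const_mul _)).exp
    have iE : Integrable E P := integrable_exp_noise hξ hs l v t
    set g : Ω → ℝ := fun ω => if v ∈ s t ω then E ω else 0 with hg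
    have mg : Measurable[ℱ t] g := Measurable.ite hA mE measurable_const
    have eg : g = {ω | v ∈ s t ω}.indicator E := by
      ext ω
      simp [hg, Set.indicator]
    have ig : Integrable g P := by
      rw [eg]
      exact iE.indicator (ℱ.le t _ hA)
    have ig' : Integrable (fun ω => E ω - g ω) P := iE.sub ig
    have hpt : ∀ ω, Real.exp (l * noise P ξ s v (t + 1) ω -
        l ^ 2 / 8 * numPlays s (t + 1) ω v) = (E ω - g ω) +
          Real.exp (-(l ^ 2 / 8)) * (g ω * Real.exp (l * (ξ t ω v - meanRate P ξ v))) := by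
      intro ω
      simp only [noise_succ, numPlays_succ, hg, hE]
      split_ifs
      · rw [sub_self, zero_add, ← Real.exp_add, ← Real.exp_add]
        congr 1
        push_cast
        ring
      · simp
    have e := hξ.integral_mul_comp v mg (φ := fun x => Real.exp (l * (x - meanRate P ξ v)))
      (by fun_prop)
    have i2 : Integrable (fun ω => Real.exp (-(l ^ 2 / 8)) *
        (g ω * Real.exp (l * (ξ t ω v - meanRate P ξ v)))) P := by
      have := (integrable_exp_noise hξ hs l v (t + 1)).sub ig'
      refine this.congr (Filter.Eventually.of_forall fun ω => ?_)
      simp only [Pi.sub_apply, hpt]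
      ring
    simp only [hpt]
    rw [integral_add ig' i2, integral_sub iE ig, integral_const_mul, e]
    have hg0 : 0 ≤ ∫ ω, g ω ∂P := integral_nonneg fun ω => by
      simp only [hg]
      split_ifs
      · exact Real.exp_nonneg _
      · exact le_rfl
    have h1 := mul_le_mul_of_nonneg_left (hξ.integral_exp_le t v l) hg0
    have h2 := mul_le_mul_of_nonneg_left h1 (Real.exp_nonneg (-(l ^ 2 / 8)))
    have h3 : Real.exp (-(l ^ 2 / 8)) * ((∫ ω, g ω ∂P) * Real.exp (l ^ 2 / 8)) =
        ∫ ω, g ω ∂P := by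
      rw [mul_left_comm, ← Real.exp_add]
      simp
    linarith

end Moments

section Moments

variable {N M : ℕ} {Ω : Type*} [mΩ : MeasurableSpace Ω] {P : Measure Ω}
  {ℱ : Filtration ℕ mΩ} {ξ : ℕ → Ω → Fin N × Fin M → ℝ} {s : ℕ → Ω → Finset (Fin N × Fin M)}

/-! ### Estimation error in the rounds in which a vertex is played -/

/-- The error `|μ̃_v - μ_v|` of the observed mean of `v` before round `t`, counted only if `v` is
played in that round.  It is `0` before the first observation, where the quotient is `0 / 0`. -/
noncomputable def playedError (P : Measure Ω) (ξ : ℕ → Ω → Fin N × Fin M → ℝ)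
    (s : ℕ → Ω → Finset (Fin N × Fin M)) (v : Fin N × Fin M) (t : ℕ) (ω : Ω) : ℝ :=
  if v ∈ s t ω then |noise P ξ s v t ω| / (numPlays s t ω v : ℝ) else 0

theorem measurable_cast_numPlays (hs : ∀ t F, MeasurableSet[ℱ t] {ω | s t ω = F}) (t : ℕ)
    (v : Fin N × Fin M) : Measurable fun ω => (numPlays s t ω v : ℝ) :=
  (measurable_from_nat (f := fun j : ℕ => (j : ℝ))).comp
    ((measurable_numPlays hs t v).mono (ℱ.le t) le_rfl)

theorem integrable_playedError [IsProbabilityMeasure P] (hξ : IsRateProcess P ℱ ξ)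
    (hs : ∀ t F, MeasurableSet[ℱ t] {ω | s t ω = F}) (v : Fin N × Fin M) (t : ℕ) :
    Integrable (playedError P ξ s v t) P := by
  have hZ := (measurable_noise hξ hs t v).mono (ℱ.le t) le_rfl
  have hA := ℱ.le t _ (measurableSet_mem hs t v)
  refine Integrable.of_bound (Measurable.ite hA
    (hZ.abs.div (measurable_cast_numPlays hs t v)) measurable_const).aestronglyMeasurable 1 ?_
  filter_upwards [ae_abs_noise_le (s := s) hξ] with ω hω
  unfold playedError
  split_ifs
  · rw [Real.norm_of_nonneg (by positivity)]
    exact div_le_one_of_le₀ (hω t v) (Nat.cast_nonneg _)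
  · simp

theorem playedError_le (v : Fin N × Fin M) (t : ℕ) (ω : Ω) :
    playedError P ξ s v t ω ≤
      (if v ∈ s t ω then 1 / 2 * (1 / √(numPlays s t ω v : ℝ)) else 0) +
        2 * potentialDrop P ξ s (fun j => 1 / √((max j 1 : ℕ) : ℝ)) v t ω := by
  unfold playedError potentialDrop
  split_ifs
  · rcases Nat.eq_zero_or_pos (numPlays s t ω v) with h | h
    · simp [h]
    · set m := numPlays s t ω v
      set Z := noise P ξ s v t ω
      have hm1 : (1 : ℝ) ≤ m := by exact_mod_cast h
      have hm0 : (0 : ℝ) < m := by linarith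
      beta_reduce
      rw [max_eq_left (show 1 ≤ m from h), max_eq_left (show 1 ≤ m + 1 by omega)]
      have h1 := mul_le_mul_of_nonneg_left (one_div_sqrt_sub_ge hm1) (sq_nonneg Z)
      have hs : 0 < √(m : ℝ) := Real.sqrt_pos.2 hm0
      have hss : √(m : ℝ) * √(m : ℝ) = m := Real.mul_self_sqrt hm0.le
      -- The weighted inequality `2 a b ≤ a ^ 2 + b ^ 2` that balances both sums.
      have h2 : |Z| / m ≤ 1 / 2 * (1 / √(m : ℝ)) + 2 * (Z ^ 2 * (1 / (4 * (m * √(m : ℝ))))) := by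
        have e : 1 / 2 * (1 / √(m : ℝ)) + 2 * (Z ^ 2 * (1 / (4 * (m * √(m : ℝ))))) - |Z| / m =
            (|Z| - √(m : ℝ)) ^ 2 / (2 * (m * √(m : ℝ))) := by
          field_simp
          rw [← sq_abs Z]
          linear_combination (-4) * hss
        have : 0 ≤ (|Z| - √(m : ℝ)) ^ 2 / (2 * (m * √(m : ℝ))) := by positivity
        linarith
      push_cast at h1 ⊢
      linarith
  · simp

/-- For the weight `h m = m ^ (-1/2)` the drop at a play is at least `Z² / (4 m ^ (3/2))`, and
`|Z| / m ≤ m ^ (-1/2) / 2 + Z² / (2 m ^ (3/2))`. -/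
theorem integral_sum_playedError_le [IsProbabilityMeasure P] (hξ : IsRateProcess P ℱ ξ)
    (hs : ∀ t F, MeasurableSet[ℱ t] {ω | s t ω = F}) (v : Fin N × Fin M) (n : ℕ) :
    ∑ t ∈ Finset.range n, ∫ ω, playedError P ξ s v t ω ∂P ≤ 2 * √(n : ℝ) := by
  set h : ℕ → ℝ := fun j => 1 / √((max j 1 : ℕ) : ℝ) with hh
  have h0 : ∀ j, 0 ≤ h j := fun j => by positivity
  have hanti : Antitone h := by
    intro i j hij
    simp only [hh]
    have : 0 < ((max i 1 : ℕ) : ℝ) := by positivity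
    gcongr
  have iD := fun t => integrable_potentialDrop hξ hs h0 hanti v t
  have hsum : ∀ ω, ∑ t ∈ Finset.range n, playedError P ξ s v t ω ≤
      √(n : ℝ) + 2 * ∑ t ∈ Finset.range n, potentialDrop P ξ s h v t ω := by
    intro ω
    have h1 := Finset.sum_le_sum fun t (_ : t ∈ Finset.range n) =>
      playedError_le (P := P) (ξ := ξ) (s := s) v t ω
    rw [Finset.sum_add_distrib, ← Finset.mul_sum] at h1
    have h2 := sum_plays_le s ω v (f := fun j => 1 / 2 * (1 / √(j : ℝ)))
      (fun j => by positivity) n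
    have h3 := sum_rpow_le (p := 1 / 2) (by norm_num) (by norm_num) n
    have h4 : ∑ j ∈ Finset.range n, 1 / 2 * (1 / √(j : ℝ)) =
        1 / 2 * ∑ j ∈ Finset.range n, (j : ℝ) ^ ((1 / 2 : ℝ) - 1) := by
      rw [Finset.mul_sum]
      refine Finset.sum_congr rfl fun j _ => ?_
      rw [show (1 / 2 : ℝ) - 1 = -(1 / 2) by norm_num, Real.rpow_neg (Nat.cast_nonneg j),
        ← Real.sqrt_eq_rpow, one_div (√_)]
    rw [← Real.sqrt_eq_rpow] at h3
    linarith
  rw [← integral_finsetSum _ fun t _ => integrable_playedError hξ hs v t]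
  refine (integral_mono (integrable_finsetSum _ fun t _ => integrable_playedError hξ hs v t)
    ((integrable_const _).add ((integrable_finsetSum _ fun t _ => iD t).const_mul 2)) hsum).trans ?_
  have e : ∫ ω, (√(n : ℝ) + 2 * ∑ t ∈ Finset.range n, potentialDrop P ξ s h v t ω) ∂P =
      √(n : ℝ) + 2 * ∑ t ∈ Finset.range n, ∫ ω, potentialDrop P ξ s h v t ω ∂P := by
    rw [integral_add (integrable_const _) ((integrable_finsetSum _ fun t _ => iD t).const_mul 2),
      integral_const_mul, integral_finsetSum _ fun t _ => iD t]
    simp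
  refine e.le.trans ?_
  have h5 := integral_sq_noise_add_drop_le hξ hs h0 hanti v n
  have h6 : 0 ≤ ∫ ω, noise P ξ s v n ω ^ 2 * h (numPlays s n ω v) ∂P :=
    integral_nonneg fun ω => mul_nonneg (sq_nonneg _) (h0 _)
  have h7 : ∑ j ∈ Finset.range n, h (j + 1) =
      ∑ j ∈ Finset.range n, ((j : ℝ) + 1) ^ ((1 / 2 : ℝ) - 1) := by
    refine Finset.sum_congr rfl fun j _ => ?_
    simp only [hh]
    rw [max_eq_left (show 1 ≤ j + 1 by omega), show (1 / 2 : ℝ) - 1 = -(1 / 2) by norm_num,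
      Real.rpow_neg (by positivity), ← Real.sqrt_eq_rpow, one_div]
    push_cast
    rfl
  have h8 := sum_succ_rpow_le (p := 1 / 2) (by norm_num) (by norm_num) n
  rw [← Real.sqrt_eq_rpow] at h8
  linarith

/-! ### Underestimation of a vertex -/

/-- The exploration bonus of a vertex with `m` plays in the first `t` rounds. -/
noncomputable def explorationBonus (N M t m : ℕ) : ℝ :=
  √(max (Real.log ((t : ℝ) ^ (2 / 3 : ℝ) / (((N : ℝ) * (M : ℝ)) * (m : ℝ)))) 0 / (m : ℝ))

/-- By how much the finite estimated weight of `v` before round `t` lies below its mean rate.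
Without observations of `v` (infinite weight) all quotients are `0`, and so is the shortfall. -/
noncomputable def shortfall (P : Measure Ω) (ξ : ℕ → Ω → Fin N × Fin M → ℝ)
    (s : ℕ → Ω → Finset (Fin N × Fin M)) (v : Fin N × Fin M) (t : ℕ) (ω : Ω) : ℝ :=
  max (-(noise P ξ s v t ω / (numPlays s t ω v : ℝ)) -
    explorationBonus N M t (numPlays s t ω v)) 0

theorem shortfall_nonneg (v : Fin N × Fin M) (t : ℕ) (ω : Ω) : 0 ≤ shortfall P ξ s v t ω :=
  le_max_right _ _

theorem shortfall_le (v : Fin N × Fin M) (t : ℕ) (ω : Ω) :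
    shortfall P ξ s v t ω ≤ |noise P ξ s v t ω| / (numPlays s t ω v : ℝ) := by
  refine max_le ?_ (by positivity)
  have h1 : 0 ≤ explorationBonus N M t (numPlays s t ω v) := Real.sqrt_nonneg _
  have h2 : -(noise P ξ s v t ω / (numPlays s t ω v : ℝ)) ≤
      |noise P ξ s v t ω| / (numPlays s t ω v : ℝ) := by
    rw [← neg_div]
    exact div_le_div_of_nonneg_right (neg_le_abs _) (Nat.cast_nonneg _)
  linarith

theorem integrable_shortfall [IsProbabilityMeasure P] (hξ : IsRateProcess P ℱ ξ)
    (hs : ∀ t F, MeasurableSet[ℱ t] {ω | s t ω = F}) (v : Fin N × Fin M) (t : ℕ) :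
    Integrable (shortfall P ξ s v t) P := by
  have hZ := (measurable_noise hξ hs t v).mono (ℱ.le t) le_rfl
  have hm := (measurable_numPlays hs t v).mono (ℱ.le t) le_rfl
  refine Integrable.of_bound (((hZ.div (measurable_cast_numPlays hs t v)).neg.sub
    ((measurable_from_nat (f := explorationBonus N M t)).comp hm)).max
      measurable_const).aestronglyMeasurable 1 ?_
  filter_upwards [ae_abs_noise_le (s := s) hξ] with ω hω
  refine (Real.norm_of_nonneg (le_max_right _ _)).le.trans
    ((shortfall_le (P := P) (ξ := ξ) (s := s) v t ω).trans ?_)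
  exact div_le_one_of_le₀ (hω t v) (Nat.cast_nonneg _)

/-- With fewer than `m₀` observations, a positive shortfall after `m` plays forces the exponential
supermartingale with parameter `-4 c_m`, where `c_m` is the bonus, to exceed the square of
`t ^ (2 / 3) / (K m)`.  With `m₀` or more observations the shortfall is bounded by the error of
the observed mean. -/
theorem shortfall_le_exp_add_sq (hK : 0 < (N : ℝ) * M) {t m₀ : ℕ} (ht : 1 ≤ t) (hm₀ : 1 ≤ m₀)
    (v : Fin N × Fin M) {ω : Ω}
    (hω : |noise P ξ s v t ω| ≤ numPlays s t ω v) {η : ℝ} (hη : 0 < η) :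
    shortfall P ξ s v t ω ≤
      ∑ m ∈ Finset.range m₀, ((((N : ℝ) * M) * m) / (t : ℝ) ^ (2 / 3 : ℝ)) ^ 2 *
          Real.exp (-4 * explorationBonus N M t m * noise P ξ s v t ω -
            (-4 * explorationBonus N M t m) ^ 2 / 8 * numPlays s t ω v) +
        (η / 2 + 1 / (2 * η) * (noise P ξ s v t ω ^ 2 *
          (1 / ((max (numPlays s t ω v) m₀ : ℕ) : ℝ) ^ 2))) := by
  have hS : ∀ m ∈ Finset.range m₀, 0 ≤ ((((N : ℝ) * M) * m) / (t : ℝ) ^ (2 / 3 : ℝ)) ^ 2 *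
      Real.exp (-4 * explorationBonus N M t m * noise P ξ s v t ω -
        (-4 * explorationBonus N M t m) ^ 2 / 8 * numPlays s t ω v) :=
    fun m _ => by positivity
  have hR : 0 ≤ η / 2 + 1 / (2 * η) * (noise P ξ s v t ω ^ 2 *
          (1 / ((max (numPlays s t ω v) m₀ : ℕ) : ℝ) ^ 2)) := by positivity
  set m := numPlays s t ω v with hm
  set Z := noise P ξ s v t ω with hZ
  have hle := shortfall_le (P := P) (ξ := ξ) (s := s) v t ω
  rw [← hm, ← hZ] at hle
  rcases lt_or_ge m m₀ with h | h
  · suffices hsuff : shortfall P ξ s v t ω ≤ ∑ m ∈ Finset.range m₀,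
        ((((N : ℝ) * M) * m) / (t : ℝ) ^ (2 / 3 : ℝ)) ^ 2 *
          Real.exp (-4 * explorationBonus N M t m * Z -
            (-4 * explorationBonus N M t m) ^ 2 / 8 * numPlays s t ω v) from
      hsuff.trans (le_add_of_nonneg_right hR)
    rcases Nat.eq_zero_or_pos m with hm0 | hmpos
    · rw [hm0, Nat.cast_zero, div_zero] at hle
      exact hle.trans (Finset.sum_nonneg hS)
    have hmr : (0 : ℝ) < m := by exact_mod_cast hmpos
    rcases le_or_gt (-(Z / m) - explorationBonus N M t m) 0 with hneg | hpos
    · rw [shortfall, ← hm, ← hZ, max_eq_right hneg]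
      exact Finset.sum_nonneg hS
    refine le_trans ?_ (Finset.single_le_sum hS (Finset.mem_range.2 h))
    refine (hle.trans (div_le_one_of_le₀ hω hmr.le)).trans ?_
    set c := explorationBonus N M t m with hc
    have hc0 : 0 ≤ c := Real.sqrt_nonneg _
    have ht0 : (0 : ℝ) < (t : ℝ) ^ (2 / 3 : ℝ) :=
      Real.rpow_pos_of_pos (by exact_mod_cast ht) _
    set x : ℝ := (t : ℝ) ^ (2 / 3 : ℝ) / (((N : ℝ) * M) * m) with hx
    have hx0 : 0 < x := by positivity
    have hcm : c ^ 2 * m = max (Real.log x) 0 := by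
      rw [hc, explorationBonus, Real.sq_sqrt (by positivity), div_mul_cancel₀ _ hmr.ne']
    have hZc : c * m ≤ -Z := by
      have : c < -Z / m := by
        rw [neg_div]
        linarith
      exact ((lt_div_iff₀ hmr).1 this).le
    have hexp : 2 * Real.log x ≤ -4 * c * Z - (-4 * c) ^ 2 / 8 * m := by
      have h1 := mul_le_mul_of_nonneg_left hZc hc0
      have h2 := le_max_left (Real.log x) 0
      nlinarith
    have hxinv : (((N : ℝ) * M) * m) / (t : ℝ) ^ (2 / 3 : ℝ) = x⁻¹ := by
      rw [hx, inv_div]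
    rw [hxinv]
    calc (1 : ℝ) = x⁻¹ ^ 2 * Real.exp (2 * Real.log x) := by
          rw [two_mul, Real.exp_add, Real.exp_log hx0]
          field_simp
      _ ≤ _ := by gcongr
  · refine le_trans ?_ (le_add_of_nonneg_left (Finset.sum_nonneg hS))
    rw [max_eq_left h]
    have hmr : (0 : ℝ) < m := by exact_mod_cast (lt_of_lt_of_le hm₀ h)
    refine hle.trans ?_
    have e : η / 2 + 1 / (2 * η) * (Z ^ 2 * (1 / (m : ℝ) ^ 2)) - |Z| / m =
        (|Z| / m - η) ^ 2 / (2 * η) := by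
      field_simp
      rw [← sq_abs Z]
      ring
    have : 0 ≤ (|Z| / m - η) ^ 2 / (2 * η) := by positivity
    linarith

/-- The quadratic term is bounded by the second-moment budget of the weight
`1 / max (m, m₀) ^ 2`; the value `1 / √(2 m₀)` of the free parameter is the optimal one. -/
theorem integral_shortfall_le [IsProbabilityMeasure P] (hξ : IsRateProcess P ℱ ξ)
    (hs : ∀ t F, MeasurableSet[ℱ t] {ω | s t ω = F}) (hK : 0 < (N : ℝ) * M) {t m₀ : ℕ}
    (ht : 1 ≤ t) (hm₀ : 1 ≤ m₀) (v : Fin N × Fin M) :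
    ∫ ω, shortfall P ξ s v t ω ∂P ≤
      ∑ m ∈ Finset.range m₀, ((((N : ℝ) * M) * m) / (t : ℝ) ^ (2 / 3 : ℝ)) ^ 2 +
        1 / √(2 * m₀) := by
  have hm0 : (0 : ℝ) < m₀ := by exact_mod_cast hm₀
  set η : ℝ := 1 / √(2 * m₀) with hη
  have hη0 : 0 < η := by positivity
  have hη2 : η ^ 2 = 1 / (2 * m₀) := by
    rw [hη, div_pow, Real.sq_sqrt (by positivity), one_pow]
  set h : ℕ → ℝ := fun j => 1 / ((max j m₀ : ℕ) : ℝ) ^ 2 with hh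
  have h0 : ∀ j, 0 ≤ h j := fun j => by positivity
  have hanti : Antitone h := by
    intro i j hij
    simp only [hh]
    have : 0 < ((max i m₀ : ℕ) : ℝ) := by positivity
    gcongr
  have iE := fun m : ℕ => (integrable_exp_noise hξ hs (-4 * explorationBonus N M t m) v t).const_mul
    (((((N : ℝ) * M) * m) / (t : ℝ) ^ (2 / 3 : ℝ)) ^ 2)
  have iS := integrable_finsetSum (Finset.range m₀) fun m _ => iE m
  have iZ := (integrable_sq_noise_mul hξ hs h0 hanti v t).const_mul (1 / (2 * η))
  have iR : Integrable (fun ω => η / 2 + 1 / (2 * η) * (noise P ξ s v t ω ^ 2 *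
      h (numPlays s t ω v))) P := (integrable_const _).add iZ
  refine (integral_mono_ae (integrable_shortfall hξ hs v t) (iS.add iR) ?_).trans ?_
  · filter_upwards [ae_abs_noise_le (s := s) hξ] with ω hω
    exact shortfall_le_exp_add_sq hK ht hm₀ v (hω t v) hη0
  · rw [integral_add' iS iR, integral_finsetSum _ fun m _ => iE m,
      integral_add (integrable_const _) iZ, integral_const_mul]
    have h1 := integral_sq_noise_add_drop_le hξ hs h0 hanti v t
    have h2 : 0 ≤ ∑ τ ∈ Finset.range t, ∫ ω, potentialDrop P ξ s h v τ ω ∂P :=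
      Finset.sum_nonneg fun τ _ => integral_nonneg fun ω => by
        unfold potentialDrop
        split_ifs
        · exact mul_nonneg (sq_nonneg _) (sub_nonneg.2 (hanti (Nat.le_succ _)))
        · exact le_rfl
    have h3 := sum_inv_max_sq_le hm₀ t
    have h4 : ∫ ω, noise P ξ s v t ω ^ 2 * h (numPlays s t ω v) ∂P ≤ η ^ 2 := by
      rw [hη2]
      have : 1 / (2 * (m₀ : ℝ)) = 1 / 4 * (2 / m₀) := by
        field_simp
        norm_num
      linarith
    have h5 : ∫ ω, η / 2 ∂P + 1 / (2 * η) *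
        ∫ ω, noise P ξ s v t ω ^ 2 * h (numPlays s t ω v) ∂P ≤ η := by
      have h6 : 1 / (2 * η) * ∫ ω, noise P ξ s v t ω ^ 2 * h (numPlays s t ω v) ∂P ≤
          1 / (2 * η) * η ^ 2 := mul_le_mul_of_nonneg_left h4 (by positivity)
      have h7 : 1 / (2 * η) * η ^ 2 = η / 2 := by
        field_simp
      simp only [integral_const, probReal_univ, one_smul]
      linarith
    refine add_le_add (Finset.sum_le_sum fun m _ => ?_) h5
    rw [integral_const_mul]
    exact mul_le_of_le_one_right (sq_nonneg _)
      (integral_exp_noise_le_one hξ hs (-4 * explorationBonus N M t m) v t)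

/-- The choice `m₀ ≈ (3 / 4) t ^ (1 / 3)` balances the two parts of the shortfall. -/
theorem integral_shortfall_le_rpow [IsProbabilityMeasure P] (hξ : IsRateProcess P ℱ ξ)
    (hs : ∀ t F, MeasurableSet[ℱ t] {ω | s t ω = F}) (hK : 0 < (N : ℝ) * M)
    (v : Fin N × Fin M) (t : ℕ) :
    ∫ ω, shortfall P ξ s v t ω ∂P ≤
      1 / 2 * ((N : ℝ) * M) ^ 2 * (t : ℝ) ^ ((2 / 3 : ℝ) - 1) +
        5 / 6 * (t : ℝ) ^ ((5 / 6 : ℝ) - 1) := by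
  rcases Nat.eq_zero_or_pos t with rfl | ht
  · have h1 : ∀ ω, shortfall P ξ s v 0 ω = 0 := fun ω =>
      le_antisymm (by simpa [numPlays_zero] using shortfall_le (P := P) (ξ := ξ) (s := s) v 0 ω)
        (shortfall_nonneg v 0 ω)
    simp only [h1, integral_zero]
    positivity
  have htr : (0 : ℝ) < t := by exact_mod_cast ht
  set r : ℝ := (t : ℝ) ^ (1 / 3 : ℝ) with hr
  have hr0 : 0 < r := Real.rpow_pos_of_pos htr _
  have e1 : (t : ℝ) ^ (2 / 3 : ℝ) = r ^ 2 := by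
    rw [hr, ← Real.rpow_natCast, ← Real.rpow_mul htr.le]
    norm_num
  have e2 : (t : ℝ) ^ ((2 / 3 : ℝ) - 1) = r⁻¹ := by
    rw [hr, ← Real.rpow_neg htr.le]
    norm_num
  have e3 : (t : ℝ) ^ ((5 / 6 : ℝ) - 1) = 1 / √r := by
    rw [hr, Real.sqrt_eq_rpow, ← Real.rpow_mul htr.le, one_div, ← Real.rpow_neg htr.le]
    norm_num
  set m₀ : ℕ := ⌈3 / 4 * r⌉₊ with hm
  have hm₀ : 1 ≤ m₀ := Nat.ceil_pos.2 (by positivity)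
  refine (integral_shortfall_le hξ hs hK ht hm₀ v).trans (add_le_add ?_ ?_)
  · have hlt : ∀ j : ℕ, j < m₀ → (j : ℝ) < 3 / 4 * r := fun j hj => Nat.lt_ceil.1 hj
    have hsum : ∑ m ∈ Finset.range m₀, (m : ℝ) ^ 2 ≤ (3 / 4 * r) ^ 3 := by
      obtain ⟨k, hk⟩ : ∃ k, m₀ = k + 1 := ⟨m₀ - 1, by omega⟩
      rw [hk, Finset.sum_range_succ']
      have : ∑ j ∈ Finset.range k, ((j + 1 : ℕ) : ℝ) ^ 2 ≤
          ∑ _j ∈ Finset.range k, (3 / 4 * r) ^ 2 := by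
        refine Finset.sum_le_sum fun j hj => ?_
        have := (hlt (j + 1) (by have := Finset.mem_range.1 hj; omega)).le
        gcongr
      rw [Finset.sum_const, Finset.card_range, nsmul_eq_mul] at this
      have h2 : (k : ℝ) * (3 / 4 * r) ^ 2 ≤ 3 / 4 * r * (3 / 4 * r) ^ 2 := by
        have := (hlt k (by omega)).le
        gcongr
      simp only [Nat.cast_zero]
      linarith [show (3 / 4 * r) ^ 3 = 3 / 4 * r * (3 / 4 * r) ^ 2 by ring]
    have e4 : ∑ m ∈ Finset.range m₀, ((((N : ℝ) * M) * m) / (t : ℝ) ^ (2 / 3 : ℝ)) ^ 2 =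
        ((N : ℝ) * M) ^ 2 / r ^ 4 * ∑ m ∈ Finset.range m₀, (m : ℝ) ^ 2 := by
      rw [Finset.mul_sum]
      refine Finset.sum_congr rfl fun m _ => ?_
      rw [e1]
      ring
    rw [e4, e2]
    calc ((N : ℝ) * M) ^ 2 / r ^ 4 * ∑ m ∈ Finset.range m₀, (m : ℝ) ^ 2
        ≤ ((N : ℝ) * M) ^ 2 / r ^ 4 * (3 / 4 * r) ^ 3 := by gcongr
      _ = 27 / 64 * (((N : ℝ) * M) ^ 2 * r⁻¹) := by
          field_simp
          ring
      _ ≤ 1 / 2 * (((N : ℝ) * M) ^ 2 * r⁻¹) := by gcongr ?_ * _; norm_num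
      _ = _ := by ring
  · rw [e3]
    have h1 : 3 / 4 * r ≤ m₀ := Nat.le_ceil _
    have h2 : 6 / 5 * √r ≤ √(2 * m₀) := by
      rw [show (6 / 5 : ℝ) = √((6 / 5) ^ 2) by rw [Real.sqrt_sq (by norm_num)],
        ← Real.sqrt_mul (by positivity)]
      apply Real.sqrt_le_sqrt
      linarith
    have h3 : 0 < √r := Real.sqrt_pos.2 hr0
    calc 1 / √(2 * (m₀ : ℝ)) ≤ 1 / (6 / 5 * √r) := by gcongr
      _ = 5 / 6 * (1 / √r) := by
          field_simp

theorem sum_integral_shortfall_le [IsProbabilityMeasure P] (hξ : IsRateProcess P ℱ ξ)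
    (hs : ∀ t F, MeasurableSet[ℱ t] {ω | s t ω = F}) (hK : 0 < (N : ℝ) * M)
    (v : Fin N × Fin M) (n : ℕ) :
    ∑ t ∈ Finset.range n, ∫ ω, shortfall P ξ s v t ω ∂P ≤
      3 / 4 * ((N : ℝ) * M) ^ 2 * (n : ℝ) ^ (2 / 3 : ℝ) + (n : ℝ) ^ (5 / 6 : ℝ) := by
  refine (Finset.sum_le_sum fun t _ => integral_shortfall_le_rpow hξ hs hK v t).trans ?_
  rw [Finset.sum_add_distrib, ← Finset.mul_sum, ← Finset.mul_sum]
  have h1 := sum_rpow_le (p := 2 / 3) (by norm_num) (by norm_num) n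
  have h2 := sum_rpow_le (p := 5 / 6) (by norm_num) (by norm_num) n
  have h3 := mul_le_mul_of_nonneg_left h1 (show 0 ≤ 1 / 2 * ((N : ℝ) * M) ^ 2 by positivity)
  linarith

end Moments

section Regret

variable {N M : ℕ} {G : SimpleGraph (Fin N)} {Ω : Type*}
  {s : ℕ → Ω → Finset (Fin N × Fin M)}

/-! ### Feasible strategies -/

theorem singleton_mem_feasibleStrategies (G : SimpleGraph (Fin N)) (v : Fin N × Fin M) :
    {v} ∈ feasibleStrategies M G := by
  simp [feasibleStrategies, SimpleGraph.IsIndepSet]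

/-- A feasible strategy uses at most one channel per node. -/
theorem card_le_of_mem_feasibleStrategies {F : Finset (Fin N × Fin M)}
    (hF : F ∈ feasibleStrategies M G) : F.card ≤ N := by
  have hF' : (extendedConflictGraph M G).IsIndepSet (F : Set (Fin N × Fin M)) := by
    simpa [feasibleStrategies] using hF
  have hinj : Set.InjOn Prod.fst (F : Set (Fin N × Fin M)) := by
    intro u hu w hw h
    by_contra hne
    exact hF' hu hw hne (Or.inl ⟨h, fun h' => hne (Prod.ext h h')⟩)
  calc F.card = (F.image Prod.fst).card := (Finset.card_image_of_injOn hinj).symm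
    _ ≤ (Finset.univ : Finset (Fin N)).card := Finset.card_le_univ _
    _ = N := by simp

theorem exists_optThroughput_eq (G : SimpleGraph (Fin N)) (μ : Fin N × Fin M → ℝ) :
    ∃ F ∈ feasibleStrategies M G, optThroughput G μ = meanThroughput μ F :=
  Finset.exists_mem_eq_sup' _ _

theorem sum_le_of_mem_feasibleStrategies {F : Finset (Fin N × Fin M)}
    (hF : F ∈ feasibleStrategies M G) {f : Fin N × Fin M → ℝ} {c : ℝ} (hc : 0 ≤ c)
    (hf : ∀ v ∈ F, f v ≤ c) : ∑ v ∈ F, f v ≤ N * c := by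
  refine (Finset.sum_le_card_nsmul F f c hf).trans ?_
  rw [nsmul_eq_mul]
  have : (F.card : ℝ) ≤ N := by exact_mod_cast card_le_of_mem_feasibleStrategies hF
  gcongr

theorem optThroughput_le {μ : Fin N × Fin M → ℝ} (hμ : ∀ v, μ v ≤ 1) :
    optThroughput G μ ≤ N := by
  obtain ⟨F, hF, hFeq⟩ := exists_optThroughput_eq G μ
  rw [hFeq]
  simpa [meanThroughput] using sum_le_of_mem_feasibleStrategies hF zero_le_one fun v _ => hμ v

/-! ### The regret as a sum over rounds -/

/-- Counting plays by strategies or by rounds gives the same sum. -/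
theorem sum_timesPlayed_mul (hs : ∀ t ω, s t ω ∈ feasibleStrategies M G) (n : ℕ) (ω : Ω)
    (f : Finset (Fin N × Fin M) → ℝ) :
    ∑ F ∈ feasibleStrategies M G, f F * (timesPlayed s n F ω : ℝ) =
      ∑ t ∈ Finset.range n, f (s t ω) := by
  have h1 : ∀ F, f F * (timesPlayed s n F ω : ℝ) =
      ∑ t ∈ Finset.range n, if s t ω = F then f F else 0 := by
    intro F
    rw [← Finset.sum_filter, Finset.sum_const, nsmul_eq_mul, timesPlayed, mul_comm]
  simp only [h1]
  rw [Finset.sum_comm]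
  refine Finset.sum_congr rfl fun t _ => ?_
  rw [Finset.sum_ite_eq, if_pos (hs t ω)]

variable [mΩ : MeasurableSpace Ω] {P : Measure Ω} {ℱ : Filtration ℕ mΩ}
  {ξ : ℕ → Ω → Fin N × Fin M → ℝ}

theorem measurable_comp_strategy (hs : ∀ t F, MeasurableSet[ℱ t] {ω | s t ω = F}) (t : ℕ)
    (f : Finset (Fin N × Fin M) → ℝ) : Measurable[ℱ t] fun ω => f (s t ω) := by
  intro B _
  have : (fun ω => f (s t ω)) ⁻¹' B =
      ⋃ F ∈ {F : Finset (Fin N × Fin M) | f F ∈ B}, {ω | s t ω = F} := by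
    ext ω
    simp
  rw [this]
  exact MeasurableSet.biUnion (Set.to_countable _) fun F _ => hs t F

theorem integrable_comp_strategy [IsFiniteMeasure P]
    (hs : ∀ t F, MeasurableSet[ℱ t] {ω | s t ω = F}) (t : ℕ)
    (f : Finset (Fin N × Fin M) → ℝ) : Integrable (fun ω => f (s t ω)) P :=
  Integrable.of_bound
    ((measurable_comp_strategy hs t f).mono (ℱ.le t) le_rfl).aestronglyMeasurable
    (∑ F, ‖f F‖) (Filter.Eventually.of_forall fun ω =>
      Finset.single_le_sum (f := fun F => ‖f F‖) (fun _ _ => norm_nonneg _)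
        (Finset.mem_univ (s t ω)))

theorem integrable_timesPlayed [IsFiniteMeasure P]
    (hs : ∀ t F, MeasurableSet[ℱ t] {ω | s t ω = F}) (n : ℕ) (F : Finset (Fin N × Fin M)) :
    Integrable (fun ω => (timesPlayed s n F ω : ℝ)) P := by
  have : ∀ ω, (timesPlayed s n F ω : ℝ) =
      ∑ t ∈ Finset.range n, if s t ω = F then (1 : ℝ) else 0 := by
    intro ω
    simp [timesPlayed]
  simp only [this]
  exact integrable_finsetSum _ fun t _ =>
    integrable_comp_strategy hs t fun F' => if F' = F then (1 : ℝ) else 0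

theorem betaRegret_eq_sum [IsFiniteMeasure P] (hs : ∀ t F, MeasurableSet[ℱ t] {ω | s t ω = F})
    (hf : ∀ t ω, s t ω ∈ feasibleStrategies M G) (β : ℝ) (n : ℕ) :
    betaRegret G P ξ s β n = ∑ t ∈ Finset.range n,
      ∫ ω, (optThroughput G (meanRate P ξ) / β -
        meanThroughput (meanRate P ξ) (s t ω)) ∂P := by
  unfold betaRegret
  simp only [← integral_const_mul]
  rw [← integral_finsetSum _ fun F _ => (integrable_timesPlayed hs n F).const_mul _,
    ← integral_finsetSum _ fun t _ => integrable_comp_strategy hs t fun F =>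
      optThroughput G (meanRate P ξ) / β - meanThroughput (meanRate P ξ) F]
  refine integral_congr_ae (Filter.Eventually.of_forall fun ω => ?_)
  exact sum_timesPlayed_mul hf n ω fun F =>
    optThroughput G (meanRate P ξ) / β - meanThroughput (meanRate P ξ) F

/-- The rates of a round are independent of the strategy chosen for it, so the expected
throughput of the round is that of the mean rates. -/
theorem integrable_and_integral_throughput [IsProbabilityMeasure P] (hξ : IsRateProcess P ℱ ξ)
    (hs : ∀ t F, MeasurableSet[ℱ t] {ω | s t ω = F}) (t : ℕ) :
    Integrable (fun ω => ∑ v ∈ s t ω, ξ t ω v) P ∧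
      ∫ ω, ∑ v ∈ s t ω, ξ t ω v ∂P = ∫ ω, meanThroughput (meanRate P ξ) (s t ω) ∂P := by
  set g : Fin N × Fin M → Ω → ℝ := fun v ω => if v ∈ s t ω then 1 else 0 with hg
  have mg : ∀ v, Measurable[ℱ t] (g v) := fun v =>
    measurable_comp_strategy hs t fun F => if v ∈ F then (1 : ℝ) else 0
  have ig : ∀ v, Integrable (g v) P := fun v =>
    integrable_comp_strategy hs t fun F => if v ∈ F then (1 : ℝ) else 0
  have igx : ∀ v, Integrable (fun ω => g v ω * ξ t ω v) P := by
    intro v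
    refine Integrable.of_bound (((mg v).mono (ℱ.le t) le_rfl).mul
      (hξ.measurable_apply t v)).aestronglyMeasurable 1 ?_
    filter_upwards [hξ.mem_Icc t v] with ω hω
    simp only [hg]
    split_ifs
    · rw [one_mul, Real.norm_of_nonneg hω.1]
      exact hω.2
    · simp
  have e1 : ∀ ω, ∑ v ∈ s t ω, ξ t ω v = ∑ v, g v ω * ξ t ω v := by
    intro ω
    simp [hg]
  have e2 : ∀ ω, meanThroughput (meanRate P ξ) (s t ω) = ∑ v, g v ω * meanRate P ξ v := by
    intro ω
    simp [hg, meanThroughput]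
  simp only [e1, e2]
  refine ⟨integrable_finsetSum _ fun v _ => igx v, ?_⟩
  rw [integral_finsetSum _ fun v _ => igx v,
    integral_finsetSum _ fun v _ => (ig v).mul_const _]
  refine Finset.sum_congr rfl fun v _ => ?_
  rw [hξ.integral_mul_comp v (mg v) (φ := fun x => x) measurable_id,
    hξ.integral_comp_eq t v (φ := fun x => x) measurable_id, integral_mul_const]
  rfl

theorem practicalRegret_eq [IsProbabilityMeasure P] (hξ : IsRateProcess P ℱ ξ)
    (hs : ∀ t F, MeasurableSet[ℱ t] {ω | s t ω = F})
    (hf : ∀ t ω, s t ω ∈ feasibleStrategies M G) {θ : ℝ} (hθ : θ ≠ 0) (α : ℝ) (n : ℕ) :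
    practicalRegret G P ξ s θ α n = θ * betaRegret G P ξ s (θ * α) n := by
  have hT := fun t => integrable_and_integral_throughput hξ hs t
  rw [betaRegret_eq_sum hs hf, practicalRegret,
    integral_finsetSum _ fun t _ => (hT t).1.const_mul θ, Finset.mul_sum]
  have e : ∀ t, θ * ∫ ω, (optThroughput G (meanRate P ξ) / (θ * α) -
      meanThroughput (meanRate P ξ) (s t ω)) ∂P =
        optThroughput G (meanRate P ξ) / α - ∫ ω, θ * ∑ v ∈ s t ω, ξ t ω v ∂P := by
    intro t
    rw [integral_const_mul, (hT t).2, integral_sub (integrable_const _)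
      (integrable_comp_strategy hs t fun F => meanThroughput (meanRate P ξ) F)]
    simp only [integral_const, probReal_univ, one_smul]
    rw [mul_sub, ← mul_div_assoc, mul_div_mul_left _ _ hθ]
  simp only [e, Finset.sum_sub_distrib, Finset.sum_const, Finset.card_range, nsmul_eq_mul]

/-! ### Decomposition of the regret of a round -/

/-- A round is wasted on a vertex without observations, or all estimated weights are finite.  In
the second case the approximation property compares the estimated weights of an optimal strategy
and of the strategy played, and the regret is at most the amount by which the former are
underestimated (divided by `β`) plus the amount by which the latter are overestimated. -/
theorem round_regret_le {β : ℝ} (hβ : 0 < β) (hμ : ∀ v, meanRate P ξ v ∈ Set.Icc (0 : ℝ) 1)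
    {ω : Ω} (hω : ∀ t v, ξ t ω v ∈ Set.Icc (0 : ℝ) 1) {t : ℕ}
    (happ : ∀ F ∈ feasibleStrategies M G, ∑ v ∈ F, estimatedWeight ξ s t ω v ≤
      ENNReal.ofReal β * ∑ v ∈ s t ω, estimatedWeight ξ s t ω v)
    {F : Finset (Fin N × Fin M)} (hF : F ∈ feasibleStrategies M G)
    (hFopt : optThroughput G (meanRate P ξ) = meanThroughput (meanRate P ξ) F) :
    optThroughput G (meanRate P ξ) / β - meanThroughput (meanRate P ξ) (s t ω) ≤
      N / β * ∑ v, (if v ∈ s t ω then (if numPlays s t ω v = 0 then (1 : ℝ) else 0) else 0) +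
        1 / β * ∑ v ∈ F, shortfall P ξ s v t ω +
        ∑ v, (playedError P ξ s v t ω +
          if v ∈ s t ω then explorationBonus N M t (numPlays s t ω v) else 0) := by
  have hI : ∀ v, (0 : ℝ) ≤
      if v ∈ s t ω then (if numPlays s t ω v = 0 then (1 : ℝ) else 0) else 0 := by
    intro v
    split_ifs <;> norm_num
  have hS : 0 ≤ ∑ v ∈ F, shortfall P ξ s v t ω :=
    Finset.sum_nonneg fun v _ => shortfall_nonneg v t ω
  have hE : ∀ v, 0 ≤ playedError P ξ s v t ω +
      if v ∈ s t ω then explorationBonus N M t (numPlays s t ω v) else 0 := by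
    intro v
    unfold playedError explorationBonus
    split_ifs
    · positivity
    · simp
  by_cases hnew : ∃ v ∈ s t ω, numPlays s t ω v = 0
  · obtain ⟨v, hv, hv0⟩ := hnew
    have h1 : (1 : ℝ) ≤ ∑ v,
        (if v ∈ s t ω then (if numPlays s t ω v = 0 then (1 : ℝ) else 0) else 0) := by
      refine le_trans ?_ (Finset.single_le_sum (fun v _ => hI v) (Finset.mem_univ v))
      simp [hv, hv0]
    have h2 : optThroughput G (meanRate P ξ) / β ≤ N / β :=
      div_le_div_of_nonneg_right (optThroughput_le fun v => (hμ v).2) hβ.le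
    have h3 : 0 ≤ meanThroughput (meanRate P ξ) (s t ω) :=
      Finset.sum_nonneg fun v _ => (hμ v).1
    have h4 := mul_le_mul_of_nonneg_left h1 (show 0 ≤ (N : ℝ) / β by positivity)
    have h5 := Finset.sum_nonneg fun v (_ : v ∈ Finset.univ) => hE v
    have h6 : 0 ≤ 1 / β * ∑ v ∈ F, shortfall P ξ s v t ω := by positivity
    linarith
  · push Not at hnew
    set w : Fin N × Fin M → ℝ := fun v =>
      observedMean ξ s t ω v + explorationBonus N M t (numPlays s t ω v) with hw
    have hw0 : ∀ v, 0 ≤ w v := fun v =>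
      add_nonneg (div_nonneg (Finset.sum_nonneg fun τ _ => (hω τ v).1) (Nat.cast_nonneg _))
        (Real.sqrt_nonneg _)
    have hwe : ∀ v, numPlays s t ω v ≠ 0 → estimatedWeight ξ s t ω v = ENNReal.ofReal (w v) := by
      intro v hv
      rw [estimatedWeight, if_neg hv]
      rfl
    have hsum : ∑ v ∈ s t ω, estimatedWeight ξ s t ω v =
        ENNReal.ofReal (∑ v ∈ s t ω, w v) := by
      rw [ENNReal.ofReal_sum_of_nonneg fun v _ => hw0 v]
      exact Finset.sum_congr rfl fun v hv => hwe v (hnew v hv)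
    -- Singletons are feasible, so a finite total weight played makes every weight finite.
    have hall : ∀ v, numPlays s t ω v ≠ 0 := by
      intro v hv
      have h := happ {v} (singleton_mem_feasibleStrategies G v)
      rw [Finset.sum_singleton, hsum, estimatedWeight, if_pos hv, ← ENNReal.ofReal_mul hβ.le] at h
      exact ENNReal.ofReal_ne_top (top_le_iff.1 h)
    have hcmp : ∑ v ∈ F, w v ≤ β * ∑ v ∈ s t ω, w v := by
      have h := happ F hF
      rw [hsum, Finset.sum_congr rfl fun v _ => hwe v (hall v),
        ← ENNReal.ofReal_sum_of_nonneg fun v _ => hw0 v, ← ENNReal.ofReal_mul hβ.le] at h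
      exact (ENNReal.ofReal_le_ofReal_iff
        (mul_nonneg hβ.le (Finset.sum_nonneg fun v _ => hw0 v))).1 h
    have hlow : ∀ v, meanRate P ξ v - w v ≤ shortfall P ξ s v t ω := by
      intro v
      simp only [hw]
      rw [observedMean_eq P ξ s v t ω (hall v)]
      refine le_trans (le_of_eq ?_) (le_max_left _ _)
      ring
    have hupp : ∑ v ∈ s t ω, w v ≤ meanThroughput (meanRate P ξ) (s t ω) +
        ∑ v, (playedError P ξ s v t ω +
          if v ∈ s t ω then explorationBonus N M t (numPlays s t ω v) else 0) := by
      have h1 : ∑ v ∈ s t ω, (w v - meanRate P ξ v) ≤ ∑ v ∈ s t ω, (playedError P ξ s v t ω +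
          if v ∈ s t ω then explorationBonus N M t (numPlays s t ω v) else 0) := by
        refine Finset.sum_le_sum fun v hv => ?_
        simp only [hw, playedError, if_pos hv]
        rw [observedMean_eq P ξ s v t ω (hall v)]
        have : noise P ξ s v t ω / (numPlays s t ω v : ℝ) ≤
            |noise P ξ s v t ω| / (numPlays s t ω v : ℝ) :=
          div_le_div_of_nonneg_right (le_abs_self _) (Nat.cast_nonneg _)
        linarith
      have h2 := Finset.sum_le_sum_of_subset_of_nonneg (Finset.subset_univ (s t ω))
        fun v _ _ => hE v
      rw [Finset.sum_sub_distrib] at h1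
      unfold meanThroughput
      linarith
    have hlow' : meanThroughput (meanRate P ξ) F - ∑ v ∈ F, w v ≤
        ∑ v ∈ F, shortfall P ξ s v t ω := by
      rw [meanThroughput, ← Finset.sum_sub_distrib]
      exact Finset.sum_le_sum fun v _ => hlow v
    have h7 : optThroughput G (meanRate P ξ) / β ≤
        1 / β * ∑ v ∈ F, shortfall P ξ s v t ω + ∑ v ∈ s t ω, w v := by
      rw [hFopt, div_le_iff₀ hβ, add_mul, mul_right_comm, one_div, inv_mul_cancel₀ hβ.ne']
      linarith
    have h8 := mul_nonneg (show 0 ≤ (N : ℝ) / β by positivity)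
      (Finset.sum_nonneg fun v (_ : v ∈ Finset.univ) => hI v)
    linarith

end Regret

section Summation

variable {N M : ℕ} {Ω : Type*} {s : ℕ → Ω → Finset (Fin N × Fin M)}

/-! ### Summation over the rounds -/

theorem log_le_div_exp_one {x : ℝ} (hx : 0 < x) : Real.log x ≤ x / Real.exp 1 := by
  have h := Real.log_le_sub_one_of_pos (div_pos hx (Real.exp_pos 1))
  rw [Real.log_div hx.ne' (Real.exp_ne_zero 1), Real.log_exp] at h
  linarith

/-- `ln x ≤ x / e` trades the logarithm in the bonus for a bound proportional to `1 / m`. -/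
theorem explorationBonus_le (hK : 0 < (N : ℝ) * M) {t n : ℕ} (htn : t ≤ n) (m : ℕ) :
    explorationBonus N M t m ≤
      √((n : ℝ) ^ (2 / 3 : ℝ) / (Real.exp 1 * ((N : ℝ) * M))) * (1 / (m : ℝ)) := by
  rcases Nat.eq_zero_or_pos m with rfl | hm
  · simp [explorationBonus]
  have hmr : (0 : ℝ) < m := by exact_mod_cast hm
  set x : ℝ := (t : ℝ) ^ (2 / 3 : ℝ) / (((N : ℝ) * M) * m) with hx
  have hx0 : 0 ≤ x := by positivity
  have hlog : max (Real.log x) 0 ≤ x / Real.exp 1 := by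
    refine max_le ?_ (by positivity)
    rcases hx0.eq_or_lt with h | h
    · simp [← h]
    · exact log_le_div_exp_one h
  have hle : max (Real.log x) 0 / m ≤
      (n : ℝ) ^ (2 / 3 : ℝ) / (Real.exp 1 * ((N : ℝ) * M)) * (1 / (m : ℝ)) ^ 2 := by
    calc max (Real.log x) 0 / m ≤ x / Real.exp 1 / m := by gcongr
      _ = (t : ℝ) ^ (2 / 3 : ℝ) / (Real.exp 1 * ((N : ℝ) * M)) * (1 / (m : ℝ)) ^ 2 := by
          rw [hx]
          field_simp
      _ ≤ _ := by gcongr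
  refine (Real.sqrt_le_sqrt hle).trans (le_of_eq ?_)
  rw [Real.sqrt_mul (by positivity), Real.sqrt_sq (by positivity)]

theorem sum_one_div_le_one_add_log {n : ℕ} (hn : 1 ≤ n) :
    ∑ j ∈ Finset.range n, 1 / (j : ℝ) ≤ 1 + Real.log n := by
  obtain ⟨k, rfl⟩ : ∃ k, n = k + 1 := ⟨n - 1, by omega⟩
  rw [Finset.sum_range_succ']
  have h1 := harmonic_le_one_add_log k
  have h2 : ((harmonic k : ℚ) : ℝ) = ∑ j ∈ Finset.range k, 1 / ((j + 1 : ℕ) : ℝ) := by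
    simp [harmonic]
  have h3 : Real.log k ≤ Real.log ((k + 1 : ℕ) : ℝ) := by
    rcases Nat.eq_zero_or_pos k with rfl | hk
    · simp
    · exact Real.log_le_log (by exact_mod_cast hk) (by push_cast; linarith)
  rw [← h2]
  simp only [Nat.cast_zero, div_zero]
  linarith

theorem sum_explorationBonus_le (hK : 0 < (N : ℝ) * M) {n : ℕ} (hn : 1 ≤ n) (ω : Ω)
    (v : Fin N × Fin M) :
    ∑ t ∈ Finset.range n,
        (if v ∈ s t ω then explorationBonus N M t (numPlays s t ω v) else 0) ≤
      √((n : ℝ) ^ (2 / 3 : ℝ) / (Real.exp 1 * ((N : ℝ) * M))) * (1 + Real.log n) := by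
  set A := √((n : ℝ) ^ (2 / 3 : ℝ) / (Real.exp 1 * ((N : ℝ) * M))) with hA
  calc ∑ t ∈ Finset.range n,
        (if v ∈ s t ω then explorationBonus N M t (numPlays s t ω v) else 0)
      ≤ ∑ t ∈ Finset.range n,
        (if v ∈ s t ω then A * (1 / (numPlays s t ω v : ℝ)) else 0) := by
        refine Finset.sum_le_sum fun t ht => ?_
        split_ifs
        · exact explorationBonus_le hK (Finset.mem_range.1 ht).le _
        · exact le_rfl
    _ ≤ ∑ j ∈ Finset.range n, A * (1 / (j : ℝ)) :=
        sum_plays_le s ω v (f := fun j => A * (1 / (j : ℝ))) (fun j => by positivity) n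
    _ ≤ _ := by
        rw [← Finset.mul_sum]
        exact mul_le_mul_of_nonneg_left (sum_one_div_le_one_add_log hn) (Real.sqrt_nonneg _)

/-- Every vertex has only one play that is its first. -/
theorem sum_first_play_le (n : ℕ) (ω : Ω) (v : Fin N × Fin M) :
    ∑ t ∈ Finset.range n,
        (if v ∈ s t ω then (if numPlays s t ω v = 0 then (1 : ℝ) else 0) else 0) ≤ 1 := by
  rw [sum_plays_eq s ω v fun j => if j = 0 then (1 : ℝ) else 0, Finset.sum_ite_eq']
  split_ifs <;> norm_num

variable {G : SimpleGraph (Fin N)} [mΩ : MeasurableSpace Ω] {P : Measure Ω} {ℱ : Filtration ℕ mΩ}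
  {ξ : ℕ → Ω → Fin N × Fin M → ℝ}

/-- The four sources of regret: first plays, underestimation of an optimal strategy, and
observation errors and exploration bonuses of the vertices played. -/
theorem betaRegret_le [IsProbabilityMeasure P] (hξ : IsRateProcess P ℱ ξ)
    {β : ℝ} (hβ : 0 < β)
    (hs : IsApproxLearningPolicy G P ℱ ξ β s) (hK : 0 < (N : ℝ) * M) {n : ℕ} (hn : 1 ≤ n) :
    betaRegret G P ξ s β n ≤
      N / β * ((N : ℝ) * M) +
        1 / β * (N * (3 / 4 * ((N : ℝ) * M) ^ 2 * (n : ℝ) ^ (2 / 3 : ℝ) +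
          (n : ℝ) ^ (5 / 6 : ℝ))) +
        ((N : ℝ) * M) * (2 * √(n : ℝ) +
          √((n : ℝ) ^ (2 / 3 : ℝ) / (Real.exp 1 * ((N : ℝ) * M))) * (1 + Real.log n)) := by
  have hna := hs.nonanticipating
  obtain ⟨F, hF, hFopt⟩ := exists_optThroughput_eq G (meanRate P ξ)
  have hcard : ((Finset.univ : Finset (Fin N × Fin M)).card : ℝ) = (N : ℝ) * M := by
    simp
  set A := √((n : ℝ) ^ (2 / 3 : ℝ) / (Real.exp 1 * ((N : ℝ) * M))) with hA
  have iR := fun t => integrable_comp_strategy (P := P) hna t fun F' =>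
    optThroughput G (meanRate P ξ) / β - meanThroughput (meanRate P ξ) F'
  have iS : Integrable (fun ω => ∑ v ∈ F, ∑ t ∈ Finset.range n, shortfall P ξ s v t ω) P :=
    integrable_finsetSum _ fun v _ => integrable_finsetSum _ fun t _ =>
      integrable_shortfall hξ hna v t
  have iE : Integrable (fun ω => ∑ v, ∑ t ∈ Finset.range n, playedError P ξ s v t ω) P :=
    integrable_finsetSum _ fun v _ => integrable_finsetSum _ fun t _ =>
      integrable_playedError hξ hna v t
  set C : ℝ := N / β * ((N : ℝ) * M) + ((N : ℝ) * M) * (A * (1 + Real.log n)) with hC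
  have hpath : ∀ᵐ ω ∂P, ∑ t ∈ Finset.range n, (optThroughput G (meanRate P ξ) / β -
      meanThroughput (meanRate P ξ) (s t ω)) ≤
        C + (1 / β * (∑ v ∈ F, ∑ t ∈ Finset.range n, shortfall P ξ s v t ω) +
          ∑ v, ∑ t ∈ Finset.range n, playedError P ξ s v t ω) := by
    filter_upwards [hξ.ae_mem_Icc, ae_all_iff.2 hs.approx] with ω hω happ
    have h1 := Finset.sum_le_sum fun t (_ : t ∈ Finset.range n) =>
      round_regret_le hβ hξ.meanRate_mem_Icc hω (happ t) hF hFopt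
    simp only [Finset.sum_add_distrib, ← Finset.mul_sum] at h1
    rw [Finset.sum_comm (s := Finset.range n) (t := Finset.univ),
      Finset.sum_comm (s := Finset.range n) (t := F),
      Finset.sum_comm (s := Finset.range n) (t := Finset.univ),
      Finset.sum_comm (s := Finset.range n) (t := Finset.univ)] at h1
    have h2 := Finset.sum_le_sum fun v (_ : v ∈ Finset.univ) => sum_first_play_le (s := s) n ω v
    have h3 := Finset.sum_le_sum fun v (_ : v ∈ Finset.univ) =>
      sum_explorationBonus_le (s := s) hK hn ω v
    rw [Finset.sum_const, nsmul_eq_mul, hcard] at h2 h3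
    have h4 := mul_le_mul_of_nonneg_left h2 (show 0 ≤ (N : ℝ) / β by positivity)
    rw [mul_one] at h4
    linarith
  rw [betaRegret_eq_sum hna hs.feasible, ← integral_finsetSum _ fun t _ => iR t]
  refine (integral_mono_ae (integrable_finsetSum _ fun t _ => iR t)
    ((integrable_const C).add ((iS.const_mul (1 / β)).add iE)) hpath).trans ?_
  have e : ∫ ω, (C + (1 / β * (∑ v ∈ F, ∑ t ∈ Finset.range n, shortfall P ξ s v t ω) +
      ∑ v, ∑ t ∈ Finset.range n, playedError P ξ s v t ω)) ∂P =
        C + (1 / β * (∑ v ∈ F, ∑ t ∈ Finset.range n, ∫ ω, shortfall P ξ s v t ω ∂P) +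
          ∑ v, ∑ t ∈ Finset.range n, ∫ ω, playedError P ξ s v t ω ∂P) := by
    have iSE : Integrable (fun ω => 1 / β * (∑ v ∈ F, ∑ t ∈ Finset.range n,
        shortfall P ξ s v t ω) + ∑ v, ∑ t ∈ Finset.range n, playedError P ξ s v t ω) P :=
      (iS.const_mul (1 / β)).add iE
    rw [integral_add (integrable_const C) iSE,
      integral_add (iS.const_mul (1 / β)) iE, integral_const_mul,
      integral_finsetSum _ fun v _ => integrable_finsetSum _ fun t _ =>
        integrable_shortfall hξ hna v t,
      integral_finsetSum _ fun v _ => integrable_finsetSum _ fun t _ =>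
        integrable_playedError hξ hna v t]
    congr 1
    · simp
    · congr 1
      · congr 1
        exact Finset.sum_congr rfl fun v _ => integral_finsetSum _ fun t _ =>
          integrable_shortfall hξ hna v t
      · exact Finset.sum_congr rfl fun v _ => integral_finsetSum _ fun t _ =>
          integrable_playedError hξ hna v t
  refine e.le.trans ?_
  have h5 := sum_le_of_mem_feasibleStrategies hF
    (f := fun v => ∑ t ∈ Finset.range n, ∫ ω, shortfall P ξ s v t ω ∂P)
    (c := 3 / 4 * ((N : ℝ) * M) ^ 2 * (n : ℝ) ^ (2 / 3 : ℝ) + (n : ℝ) ^ (5 / 6 : ℝ))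
    (by positivity) fun v _ => sum_integral_shortfall_le hξ hna hK v n
  have h6 := Finset.sum_le_sum fun v (_ : v ∈ Finset.univ) =>
    integral_sum_playedError_le hξ hna v n
  rw [Finset.sum_const, nsmul_eq_mul, hcard] at h6
  have h7 := mul_le_mul_of_nonneg_left h5 (show 0 ≤ 1 / β by positivity)
  rw [hC]
  linarith

/-- The trivial bound: a round costs at most `R₁ / β ≤ N / β`. -/
theorem betaRegret_le_mul [IsProbabilityMeasure P] (hξ : IsRateProcess P ℱ ξ)
    {β : ℝ} (hβ : 0 < β)
    (hs : ∀ t F, MeasurableSet[ℱ t] {ω | s t ω = F})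
    (hf : ∀ t ω, s t ω ∈ feasibleStrategies M G) (n : ℕ) :
    betaRegret G P ξ s β n ≤ n * (N / β) := by
  rw [betaRegret_eq_sum hs hf]
  have h : ∀ t, ∫ ω, (optThroughput G (meanRate P ξ) / β -
      meanThroughput (meanRate P ξ) (s t ω)) ∂P ≤ N / β := by
    intro t
    refine (integral_mono (integrable_comp_strategy hs t fun F =>
      optThroughput G (meanRate P ξ) / β - meanThroughput (meanRate P ξ) F)
      (integrable_const ((N : ℝ) / β)) fun ω => ?_).trans (by simp)
    have h1 : optThroughput G (meanRate P ξ) / β ≤ N / β :=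
      div_le_div_of_nonneg_right (optThroughput_le fun v => (hξ.meanRate_mem_Icc v).2) hβ.le
    have h2 : 0 ≤ meanThroughput (meanRate P ξ) (s t ω) :=
      Finset.sum_nonneg fun v _ => (hξ.meanRate_mem_Icc v).1
    beta_reduce
    linarith
  refine (Finset.sum_le_sum fun t _ => h t).trans ?_
  simp

end Summation

/-! ### The explicit constants -/

/-- The observation errors take at most `√K y ^ 4` of the available `√(e K) y ^ 4`, and the bonuses,
of order `√K y ^ 2 log y`, fit into the rest. -/
theorem overestimation_constants_le {K y : ℝ} (hK0 : 0 < K) (hy34 : 3.4 ≤ y)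
    (hsK : 2 * √K ≤ y) :
    K * (2 * y ^ 3 + √(y ^ 4 / (Real.exp 1 * K)) * (1 + 6 * Real.log y)) ≤
      √(Real.exp 1 * K) * y ^ 4 := by
  have he : 0 < Real.exp 1 := Real.exp_pos 1
  have he1 : 2.718 < Real.exp 1 := by linarith [Real.exp_one_gt_d9]
  have he2 : Real.exp 1 < 2.719 := by linarith [Real.exp_one_lt_d9]
  have hy : 0 < y := by linarith
  have hse : 0 < √(Real.exp 1) := Real.sqrt_pos.2 he
  have hse2 : √(Real.exp 1) * √(Real.exp 1) = Real.exp 1 := Real.mul_self_sqrt he.le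
  have hsk0 : 0 < √K := Real.sqrt_pos.2 hK0
  have hsk2 : √K * √K = K := Real.mul_self_sqrt hK0.le
  have hse3 : √(Real.exp 1) ≤ 1.65 := by
    rw [Real.sqrt_le_left (by norm_num)]
    norm_num
    linarith
  have e1 : √(y ^ 4 / (Real.exp 1 * K)) = y ^ 2 / (√(Real.exp 1) * √K) := by
    rw [Real.sqrt_div (by positivity), Real.sqrt_mul he.le,
      show y ^ 4 = (y ^ 2) ^ 2 by ring, Real.sqrt_sq (by positivity)]
  have hlog : 1 + 6 * Real.log y ≤ (Real.exp 1 - √(Real.exp 1)) * y ^ 2 := by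
    have h1 : Real.log y ≤ y / 2.718 :=
      (log_le_div_exp_one hy).trans (by gcongr)
    have h2 : 1.06 * y ^ 2 ≤ (Real.exp 1 - √(Real.exp 1)) * y ^ 2 := by
      gcongr
      linarith
    have h3 : y / 2.718 ≤ 0.368 * y := by
      rw [div_le_iff₀ (by norm_num)]
      linarith
    have h4 : 3.4 * y ≤ y ^ 2 := by
      rw [sq]
      gcongr
    linarith
  have e2 : K * (2 * y ^ 3 + √(y ^ 4 / (Real.exp 1 * K)) * (1 + 6 * Real.log y)) =
      √K * (2 * √K * y ^ 3 + y ^ 2 / √(Real.exp 1) * (1 + 6 * Real.log y)) := by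
    rw [e1]
    nth_rw 1 [← hsk2]
    field_simp
  rw [e2, Real.sqrt_mul he.le]
  have h4 : 2 * √K * y ^ 3 ≤ y * y ^ 3 := by gcongr
  have h5 : y ^ 2 / √(Real.exp 1) * (1 + 6 * Real.log y) ≤
      y ^ 2 / √(Real.exp 1) * ((Real.exp 1 - √(Real.exp 1)) * y ^ 2) := by gcongr
  have h6 : y ^ 2 / √(Real.exp 1) * ((Real.exp 1 - √(Real.exp 1)) * y ^ 2) =
      √(Real.exp 1) * y ^ 4 - y ^ 4 := by
    nth_rw 2 [← hse2]
    field_simp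
  have h7 : √K * (2 * √K * y ^ 3 + y ^ 2 / √(Real.exp 1) * (1 + 6 * Real.log y)) ≤
      √K * (√(Real.exp 1) * y ^ 4) := by
    gcongr
    linarith
  linarith

/-- In the regime in which the trivial bound `n N / β` on the regret is not sufficient, `y ^ 6 = n`
is large against `N` and `K`, and the leading constants absorb all lower-order terms. -/
theorem regret_constants_le {N K β y R : ℝ} (hN : 1 ≤ N) (hK : 1 ≤ K) (hβ : 0 < β) (hy : 0 < y)
    (htriv : R ≤ y ^ 6 * (N / β))
    (hR : R ≤ N / β * K + 1 / β * (N * (3 / 4 * K ^ 2 * y ^ 4 + y ^ 5)) +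
      K * (2 * y ^ 3 + √(y ^ 4 / (Real.exp 1 * K)) * (1 + 6 * Real.log y))) :
    R ≤ 1 / β * N * K +
      (√(Real.exp 1 * K) + 16 / (Real.exp 1 * β) * (1 + N) * N ^ 3) * y ^ 4 +
      1 / β * (1 + 4 * √K * N ^ 2 / (Real.exp 1 * β ^ 2)) * N ^ 2 * K * y ^ 5 := by
  have he : 0 < Real.exp 1 := Real.exp_pos 1
  have he1 : 2.718 < Real.exp 1 := by linarith [Real.exp_one_gt_d9]
  have he2 : Real.exp 1 < 2.719 := by linarith [Real.exp_one_lt_d9]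
  have hN0 : 0 < N := by linarith
  have hK0 : 0 < K := by linarith
  set B : ℝ := 16 / Real.exp 1 * (1 + N) * N ^ 2 with hB
  have hB1 : 11.7 ≤ B := by
    have h1 : 5.85 ≤ 16 / Real.exp 1 := by
      rw [le_div_iff₀ he]
      linarith
    have h2 : 2 ≤ (1 + N) * N ^ 2 := by nlinarith [sq_nonneg (N - 1)]
    have h3 := mul_le_mul h1 h2 zero_le_two (by positivity)
    rw [hB, mul_assoc]
    linarith
  have hsq : 0 ≤ √(Real.exp 1 * K) * y ^ 4 := by positivity
  have hextra : 0 ≤ 1 / β * (4 * √K * N ^ 2 / (Real.exp 1 * β ^ 2)) * N ^ 2 * K * y ^ 5 := by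
    positivity
  have hNK0 : 0 ≤ 1 / β * N * K := by positivity
  have e16 : 16 / (Real.exp 1 * β) * (1 + N) * N ^ 3 * y ^ 4 = 1 / β * N * (B * y ^ 4) := by
    rw [hB]
    field_simp
  rcases le_or_gt (y ^ 2) (B + N * K * y) with hsmall | hlarge
  · have h1 : 1 / β * N * (y ^ 4 * y ^ 2) ≤ 1 / β * N * (y ^ 4 * (B + N * K * y)) := by gcongr
    have h2 : y ^ 6 * (N / β) = 1 / β * N * (y ^ 4 * y ^ 2) := by ring
    linarith
  · have hNK : K ≤ N * K := by nlinarith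
    have hyK : N * K ≤ y := by
      have h1 : 0 < y * (y - N * K) := by nlinarith
      exact (sub_pos.1 (pos_of_mul_pos_right h1 hy.le)).le
    have hy34 : 3.4 ≤ y := by
      by_contra! h
      have : 0 ≤ N * K * y := by positivity
      nlinarith
    have hKy : 4 * K ≤ y ^ 2 := by
      rcases le_or_gt 4 y with h | h
      · nlinarith
      · nlinarith
    have hsK : 2 * √K ≤ y := by
      rw [← Real.sqrt_sq hy.le, show (2 : ℝ) = √(2 ^ 2) by rw [Real.sqrt_sq zero_le_two],
        ← Real.sqrt_mul (by norm_num)]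
      apply Real.sqrt_le_sqrt
      linarith
    have hunder : 1 / β * (N * (3 / 4 * K ^ 2 * y ^ 4 + y ^ 5)) ≤
        1 / β * N * (B * y ^ 4) + 1 / β * N ^ 2 * K * y ^ 5 := by
      have h1 : 3 / 4 * K ^ 2 + y ≤ B + N * K * y := by
        have h2 : (N * K - 1) * (N * K) ≤ (N * K - 1) * y :=
          mul_le_mul_of_nonneg_left hyK (by linarith)
        have h3 : (K - 1) * K ≤ (N * K - 1) * (N * K) :=
          mul_le_mul (by linarith) hNK hK0.le (by linarith)
        nlinarith [sq_nonneg (K - 2)]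
      have h2 : 1 / β * N * y ^ 4 * (3 / 4 * K ^ 2 + y) ≤ 1 / β * N * y ^ 4 * (B + N * K * y) :=
        mul_le_mul_of_nonneg_left h1 (by positivity)
      linarith
    have hover := overestimation_constants_le hK0 hy34 hsK
    have e3 : N / β * K = 1 / β * N * K := by ring
    linarith

theorem betaRegret_le_explicit {N M : ℕ} {G : SimpleGraph (Fin N)} {Ω : Type*}
    [mΩ : MeasurableSpace Ω] {P : Measure Ω} [IsProbabilityMeasure P] {ℱ : Filtration ℕ mΩ}
    {ξ : ℕ → Ω → Fin N × Fin M → ℝ} {s : ℕ → Ω → Finset (Fin N × Fin M)}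
    (hξ : IsRateProcess P ℱ ξ) {β : ℝ} (hβ : 0 < β) (hs : IsApproxLearningPolicy G P ℱ ξ β s)
    (n : ℕ) :
    betaRegret G P ξ s β n ≤ 1 / β * (N : ℝ) * ((N : ℝ) * M) +
      (√(Real.exp 1 * ((N : ℝ) * M)) +
        16 / (Real.exp 1 * β) * (1 + (N : ℝ)) * (N : ℝ) ^ 3) * (n : ℝ) ^ (2 / 3 : ℝ) +
      1 / β * (1 + 4 * √((N : ℝ) * M) * (N : ℝ) ^ 2 / (Real.exp 1 * β ^ 2)) * (N : ℝ) ^ 2 *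
        ((N : ℝ) * M) * (n : ℝ) ^ (5 / 6 : ℝ) := by
  have hpos : 0 ≤ 1 / β * (N : ℝ) * ((N : ℝ) * M) +
      (√(Real.exp 1 * ((N : ℝ) * M)) +
        16 / (Real.exp 1 * β) * (1 + (N : ℝ)) * (N : ℝ) ^ 3) * (n : ℝ) ^ (2 / 3 : ℝ) +
      1 / β * (1 + 4 * √((N : ℝ) * M) * (N : ℝ) ^ 2 / (Real.exp 1 * β ^ 2)) * (N : ℝ) ^ 2 *
        ((N : ℝ) * M) * (n : ℝ) ^ (5 / 6 : ℝ) := by positivity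
  rcases Nat.eq_zero_or_pos n with rfl | hn
  · refine le_trans (le_of_eq ?_) hpos
    simp [betaRegret_eq_sum hs.nonanticipating hs.feasible]
  -- Without a vertex every strategy is empty and the regret vanishes.
  rcases Nat.eq_zero_or_pos (N * M) with hNM | hNM
  · refine le_trans (le_of_eq ?_) hpos
    have hempty : ∀ F : Finset (Fin N × Fin M), F = ∅ := by
      have : IsEmpty (Fin N × Fin M) := Fintype.card_eq_zero_iff.1 (by simpa using hNM)
      exact fun F => Finset.eq_empty_of_isEmpty F
    have hz : ∀ F : Finset (Fin N × Fin M), meanThroughput (meanRate P ξ) F = 0 := fun F => by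
      rw [hempty F, meanThroughput, Finset.sum_empty]
    obtain ⟨F, -, hF⟩ := exists_optThroughput_eq (M := M) G (meanRate P ξ)
    simp [betaRegret, hF, hz]
  have hN : 1 ≤ N := Nat.pos_of_mul_pos_right hNM
  have hnr : (0 : ℝ) < n := by exact_mod_cast hn
  have hKr : (1 : ℝ) ≤ (N : ℝ) * M := by exact_mod_cast hNM
  set y : ℝ := (n : ℝ) ^ (1 / 6 : ℝ) with hy
  have hy0 : 0 < y := Real.rpow_pos_of_pos hnr _
  have e6 : (n : ℝ) = y ^ 6 := by
    rw [hy, ← Real.rpow_natCast, ← Real.rpow_mul hnr.le]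
    norm_num
  have e4 : (n : ℝ) ^ (2 / 3 : ℝ) = y ^ 4 := by
    rw [hy, ← Real.rpow_natCast, ← Real.rpow_mul hnr.le]
    norm_num
  have e5 : (n : ℝ) ^ (5 / 6 : ℝ) = y ^ 5 := by
    rw [hy, ← Real.rpow_natCast, ← Real.rpow_mul hnr.le]
    norm_num
  have e3 : √(n : ℝ) = y ^ 3 := by
    rw [e6, show y ^ 6 = (y ^ 3) ^ 2 by ring, Real.sqrt_sq (by positivity)]
  have el : Real.log (n : ℝ) = 6 * Real.log y := by
    rw [e6, Real.log_pow]
    norm_num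
  have h1 := betaRegret_le_mul hξ hβ hs.nonanticipating hs.feasible n
  have h2 := betaRegret_le hξ hβ hs (by linarith) hn
  rw [e4, e5, e3, el] at h2
  rw [e6] at h1
  rw [e4, e5]
  exact regret_constants_le (by exact_mod_cast hN) hKr hβ hy0 h1 h2

end ChannelAccess

theorem mainTheorem3 {N M : ℕ} (G : SimpleGraph (Fin N))
    {Ω : Type*} [mΩ : MeasurableSpace Ω] (P : Measure Ω) [IsProbabilityMeasure P]
    (ℱ : Filtration ℕ mΩ)
    (ξ : ℕ → Ω → Fin N × Fin M → ℝ) (hξ : ChannelAccess.IsRateProcess P ℱ ξ)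
    (ts td θ α K : ℝ) (hts : 0 ≤ ts) (htd : 0 < td) (hθ : θ = td / (ts + td)) (hα : 0 < α)
    (hK : K = (N : ℝ) * (M : ℝ))
    (s : ℕ → Ω → Finset (Fin N × Fin M))
    (hs : ChannelAccess.IsApproxLearningPolicy G P ℱ ξ (θ * α) s) (n : ℕ) :
    ChannelAccess.practicalRegret G P ξ s θ α n =
        θ * ChannelAccess.betaRegret G P ξ s (θ * α) n ∧
      θ * ChannelAccess.betaRegret G P ξ s (θ * α) n ≤
        1 / α * (N : ℝ) * K +
          (θ * √(Real.exp 1 * K) +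
              16 / (Real.exp 1 * α) * (1 + (N : ℝ)) * (N : ℝ) ^ 3) * (n : ℝ) ^ (2 / 3 : ℝ) +
          1 / α * (1 + 4 * √K * (N : ℝ) ^ 2 / (Real.exp 1 * (θ * α) ^ 2)) * (N : ℝ) ^ 2 * K *
            (n : ℝ) ^ (5 / 6 : ℝ) := by
  have hθ0 : 0 < θ := by
    rw [hθ]
    positivity
  refine ⟨ChannelAccess.practicalRegret_eq hξ hs.nonanticipating hs.feasible hθ0.ne' α n, ?_⟩
  have h := mul_le_mul_of_nonneg_left
    (ChannelAccess.betaRegret_le_explicit hξ (mul_pos hθ0 hα) hs n) hθ0.le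
  rw [← hK] at h
  refine h.trans (le_of_eq ?_)
  -- The factor `θ` turns every `1 / β` into `1 / α`.
  have e1 : θ * (1 / (θ * α)) = 1 / α := by
    field_simp
  have e2 : θ * (16 / (Real.exp 1 * (θ * α))) = 16 / (Real.exp 1 * α) := by
    field_simp
  rw [← e1, ← e2]
  ring
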